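/- Let $\mathbb{H}^1=\mathbb{C}\times\mathbb{R}$, with points $[z,t]$, $z=x+iy$, be the Heisenberg group with product $[z,t]*[z',t']=[z+z',\,t+t'+\mathrm{Im}(z\overline{z'})]$, left invariant fields $X=\partial_x+y\,\partial_t$, $Y=\partial_y-x\,\partial_t$, $T=\partial_t$, horizontal planes spanned by $X,Y$, and the Riemannian metric making $X,Y,T$ orthonormal. For measurable $E$ and open $\Omega$ let $|\partial E|(\Omega)$ be the supremum of $\int_{E\cap\Omega}\mathrm{div}\,U$ over horizontal $C^1$ fields $U$ with compact support in $\Omega$ and $|U|\le 1$. A set $E$ of locally finite perimeter is area-minimizing if $|\partial E|(\Omega)\le|\partial F|(\Omega)$ for every bounded open $\Omega$ and every measurable $F$ that coincides with $E$ outside a compact subset of $\Omega$. $E$ is a cone with center $p$ if it is mapped into itself by all maps $L_p\circ\varphi_s\circ L_p^{-1}$, $s\in\mathbb{R}$, where $L_p(q)=p*q$ and $\varphi_s[z,t]=[e^sz,e^{2s}t]$. The singular set of a $C^1$ surface is the set of its points at which the tangent plane is horizontal. The Riemannian unit normal of a graph over the $xy$-plane is taken with negative $T$-component. The horizontal halfline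 from $p$ in direction $e=e_1+ie_2$ is $\{p+w(e_1X_p+e_2Y_p):w\ge0\}$. $C^{1,1}$ means $C^1$ with Lipschitz derivative. **(a)** Let $k\ge 1$, let $\alpha_i\in(0,\pi)$, $i\in\mathbb{Z}_k$, satisfy $\sum_i\alpha_i=\pi$, and let $v_i\in\mathbb{C}$, $|v_i|=1$, satisfy $v_{i+1}=e^{\mathrm{i}(\alpha_i+\alpha_{i+1})}v_i$ for all $i\in\mathbb{Z}_k$. Let $L_i=\{sv_i:s\ge0\}$, $R_i=\{s e^{\mathrm{i}\alpha_i}v_i:s\ge0\}$, and let $W_i=\{re^{\mathrm{i}\theta}v_i:r\ge0,\ |\theta|\le\alpha_i\}$ be the closed wedge containing $L_i$ and bordered by $R_{i-1}$ and $R_i$. Let $\Sigma_\alpha$ be the union, over all $i$ and all $s\ge0$, of the two horizontal halflines from $[sv_i,0]$ in the directions $e^{\pm \mathrm{i}\alpha_i}v_i$. Then $\Sigma_\alpha$ is the graph of a $C^1$ function $u:\mathbb{R}^2\to\mathbb{R}$ such that: 1. the subgraph $\{t\le u(x,y)\}$ is area-minimizing and is a cone with center $0$; 2. $u$ is $C^{1,1}$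 in the interior of each wedge $W_i$; 3. the Riemannian unit normal $N$ of $\Sigma_\alpha$ is continuous and locally Lipschitz (in the Euclidean sense) on all of $\Sigma_\alpha$, in particular across the halflines $R_i$, and at the points over each $R_i$ it equals $N=\dfrac{-2y\,X+2x\,Y-T}{\sqrt{1+4x^2+4y^2}}$; 4. the singular set of $\Sigma_\alpha$ is the union of the horizontal halflines $L_i\times\{0\}$, $i\in\mathbb{Z}_k$. **(b)** Let $\alpha_0\in(0,\pi)$, $\beta_0=\cot\alpha_0$, and let $\Sigma_{\beta_0}$ be the union, over $v\in\mathbb{R}$, of the two horizontal halflines from $[v,0]$ in the directions $e^{\pm \mathrm{i}\alpha_0}$. Then $\Sigma_{\beta_0}$ is the graph of $u(x,y)=-xy+\beta_0\,y|y|$; its subgraph is area-minimizing and is a cone with center $[x,0]$ for every $x\in\mathbb{R}$; $u$ is $C^{1,1}$ on $\mathbb{R}^2$; the Riemannian unit normal is continuous and locally Lipschitz on $\Sigma_{\beta_0}$ and is given by the formula in 3 at the points over $\{x=\beta_0|y|\}$; and the singular set of $\Sigma_{\beta_0}$ is the horizontal line $\{[x,0]:x\in\mathbb{R}\}$. -/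

import Mathlib

open MeasureTheory
open scoped NNReal ENNReal

/-- The underlying space `ℂ × ℝ` of the Heisenberg group; a point is `[z, t]`, `z = x + iy`.
Its tangent spaces are identified with `ℂ × ℝ` through the coordinates `(x, y, t)`. -/
abbrev Heis : Type := ℂ × ℝ

namespace Heis

/-- The group law `[z, t] * [z', t'] = [z + z', t + t' + Im (z * conj z')]`. -/
noncomputable def mul (p q : Heis) : Heis :=
  (p.1 + q.1, p.2 + q.2 + (p.1 * (starRingEnd ℂ) q.1).im)

/-- The inverse for the group law `Heis.mul`. -/
noncomputable def inv (p : Heis) : Heis := (-p.1, -p.2)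

/-- The left invariant field `X = ∂x + y ∂t`. -/
noncomputable def X (p : Heis) : Heis := (1, p.1.im)

/-- The left invariant field `Y = ∂y - x ∂t`. -/
noncomputable def Y (p : Heis) : Heis := (Complex.I, -p.1.re)

/-- The left invariant field `T = ∂t`. -/
def T (_ : Heis) : Heis := (0, 1)

/-- The contact form `ω = -y dx + x dy + dt` at `p`. -/
noncomputable def omega (p : Heis) : Heis →ₗ[ℝ] ℝ where
  toFun V := -p.1.im * V.1.re + p.1.re * V.1.im + V.2
  map_add' V W := by simp only [Prod.fst_add, Prod.snd_add, Complex.add_re, Complex.add_im]; ring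
  map_smul' c V := by
    simp only [Prod.smul_fst, Prod.smul_snd, Complex.smul_re, Complex.smul_im, smul_eq_mul,
      RingHom.id_apply]
    ring

/-- The horizontal plane at `p`. -/
noncomputable def horizontalPlane (p : Heis) : Submodule ℝ Heis := LinearMap.ker (omega p)

theorem X_mem_horizontalPlane (p : Heis) : X p ∈ horizontalPlane p := by
  simp [horizontalPlane, omega, X]

theorem Y_mem_horizontalPlane (p : Heis) : Y p ∈ horizontalPlane p := by
  simp [horizontalPlane, omega, Y]

/-- The left invariant Riemannian metric for which `X`, `Y`, `T` are orthonormal. -/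
noncomputable def metric (p U V : Heis) : ℝ :=
  U.1.re * V.1.re + U.1.im * V.1.im + omega p U * omega p V

theorem metric_orthonormal (p : Heis) :
    metric p (X p) (X p) = 1 ∧ metric p (Y p) (Y p) = 1 ∧ metric p (T p) (T p) = 1 ∧
      metric p (X p) (Y p) = 0 ∧ metric p (X p) (T p) = 0 ∧ metric p (Y p) (T p) = 0 := by
  simp [metric, omega, X, Y, T]

/-- The dilation `φ_s (z, t) = (e^s z, e^{2s} t)`. -/
noncomputable def dilation (s : ℝ) (p : Heis) : Heis :=
  (Real.exp s • p.1, Real.exp (2 * s) * p.2)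

/-- The dilation with center `p`, i.e. `L_p ∘ φ_s ∘ L_p⁻¹`. -/
noncomputable def dilationAt (p : Heis) (s : ℝ) (q : Heis) : Heis :=
  mul p (dilation s (mul (inv p) q))

/-- `E` is a cone of center `p`. -/
def IsCone (E : Set Heis) (p : Heis) : Prop :=
  ∀ s : ℝ, dilationAt p s '' E ⊆ E

/-- The Riemannian divergence of the horizontal field `a X + b Y`; since `X` and `Y` are
divergence free it equals `X a + Y b`. -/
noncomputable def horizontalDiv (a b : Heis → ℝ) (p : Heis) : ℝ :=
  fderiv ℝ a p (X p) + fderiv ℝ b p (Y p)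

/-- `a X + b Y` is a `C¹` horizontal field of modulus at most one with compact support in `Ω`. -/
structure IsTestField (Ω : Set Heis) (a b : Heis → ℝ) : Prop where
  contDiff_fst : ContDiff ℝ 1 a
  contDiff_snd : ContDiff ℝ 1 b
  modulus_le : ∀ p, a p ^ 2 + b p ^ 2 ≤ 1
  compact_fst : HasCompactSupport a
  compact_snd : HasCompactSupport b
  supp_fst : tsupport a ⊆ Ω
  supp_snd : tsupport b ⊆ Ω

/-- The sub-Riemannian perimeter `|∂E|(Ω)`; the volume is Lebesgue measure. -/
noncomputable def perimeter (E Ω : Set Heis) : ℝ≥0∞ :=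
  ⨆ (a : Heis → ℝ) (b : Heis → ℝ) (_ : IsTestField Ω a b),
    ENNReal.ofReal (∫ p in E ∩ Ω, horizontalDiv a b p)

/-- Sets of locally finite perimeter. -/
def HasLocallyFinitePerimeter (E : Set Heis) : Prop :=
  NullMeasurableSet E volume ∧
    ∀ Ω : Set Heis, IsOpen Ω → Bornology.IsBounded Ω → perimeter E Ω < ⊤

/-- `E` is area-minimizing (in the whole space): it has locally finite perimeter and, in every
bounded open set `Ω`, no compactly supported modification inside `Ω` has smaller perimeter. -/
def IsAreaMinimizing (E : Set Heis) : Prop :=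
  HasLocallyFinitePerimeter E ∧
    ∀ Ω : Set Heis, IsOpen Ω → Bornology.IsBounded Ω →
      ∀ F : Set Heis, NullMeasurableSet F volume →
        (∃ K : Set Heis, IsCompact K ∧ K ⊆ Ω ∧ E \ K = F \ K) →
          perimeter E Ω ≤ perimeter F Ω

/-! Graphs over the `xy`-plane -/

/-- The `t`-graph of `u`. -/
def tGraph (u : ℂ → ℝ) : Set Heis := {p | p.2 = u p.1}

/-- The subgraph of `u`. -/
def subgraph (u : ℂ → ℝ) : Set Heis := {p | p.2 ≤ u p.1}

/-- The tangent plane at `(z, u z)` to the graph of `u` (for `u` differentiable at `z`). -/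
noncomputable def tangentPlane (u : ℂ → ℝ) (z : ℂ) : Submodule ℝ Heis :=
  LinearMap.graph (fderiv ℝ u z : ℂ →ₗ[ℝ] ℝ)

/-- The singular set of the graph of a `C¹` function `u`: the points at which the tangent plane
is the horizontal plane. -/
def singularSet (u : ℂ → ℝ) : Set Heis :=
  {p | p ∈ tGraph u ∧ tangentPlane u p.1 = horizontalPlane p}

/-- `N` is the Riemannian unit normal field along the graph of `u` that points
downwards (its `T`-component is negative). -/
def IsUnitNormalField (u : ℂ → ℝ) (N : Heis → Heis) : Prop :=
  ∀ p ∈ tGraph u, metric p (N p) (N p) = 1 ∧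
    (∀ V ∈ tangentPlane u p.1, metric p (N p) V = 0) ∧ metric p (N p) (T p) < 0

/-- The vector `(-2y X + 2x Y - T) / √(1 + 4x² + 4y²)` at `p = (x, y, t)`. -/
noncomputable def rotationNormal (p : Heis) : Heis :=
  (Real.sqrt (1 + 4 * p.1.re ^ 2 + 4 * p.1.im ^ 2))⁻¹ •
    ((-2 * p.1.im) • X p + (2 * p.1.re) • Y p - T p)

/-- `u` is of class `C^{1,1}` on the open set `S`. -/
def IsC11On (u : ℂ → ℝ) (S : Set ℂ) : Prop :=
  ContDiffOn ℝ 1 u S ∧ ∃ K : ℝ≥0, LipschitzOnWith K (fderiv ℝ u) S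

/-! The surfaces -/

/-- The horizontal halfline that leaves `p` in the direction `e₁ X + e₂ Y`, `e = e₁ + i e₂`. -/
def horizontalHalfline (p : Heis) (e : ℂ) : Set Heis :=
  {q | ∃ w : ℝ, 0 ≤ w ∧ q = p + w • (e.re • X p + e.im • Y p)}

/-- The unit complex number of argument `θ`; multiplication by it is the rotation of angle `θ`. -/
noncomputable def rot (θ : ℝ) : ℂ := Complex.exp (θ * Complex.I)

/-- The surface with the singular line `{(v, 0, 0)}` and the angle function `α`: from every point
`(v, 0, 0)` issue the two horizontal halflines making angles `± α v` with the line. -/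
def lineSurface (α : ℝ → ℝ) : Set Heis :=
  ⋃ v : ℝ, horizontalHalfline ((v : ℂ), 0) (rot (α v)) ∪
    horizontalHalfline ((v : ℂ), 0) (rot (-α v))

/-- The surface `Σ_α`: from every point `(s v_i, 0)`, `s ≥ 0`, of the horizontal halfline leaving
the origin in direction `v_i` issue the two horizontal halflines making angles `± α_i s`
with the direction `v_i`. -/
def wedgeSurface {k : ℕ} (v : Fin k → ℂ) (α : Fin k → ℝ → ℝ) : Set Heis :=
  ⋃ (i : Fin k) (s : ℝ) (_ : 0 ≤ s),
    horizontalHalfline (s • v i, 0) (rot (α i s) * v i) ∪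
      horizontalHalfline (s • v i, 0) (rot (-α i s) * v i)

/-- The planar halfline from the origin in direction `e`. -/
def planarHalfline (e : ℂ) : Set ℂ := {z | ∃ s : ℝ, 0 ≤ s ∧ z = s • e}

/-- The closed planar wedge with vertex at the origin, axis direction `e`, half-opening `a`. -/
noncomputable def wedge (e : ℂ) (a : ℝ) : Set ℂ :=
  {z | ∃ r θ : ℝ, 0 ≤ r ∧ -a ≤ θ ∧ θ ≤ a ∧ z = r • (rot θ * e)}

/-- The directions `v_i` of the halflines `L_i` and the angles `α_i`, with cyclic indices, satisfy
`∑ α_i = π` and `L_{i+1} = r_{α_i + α_{i+1}} (L_i)`, with `α_i` in `(0, π)`. -/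
structure IsConfiguration {k : ℕ} [NeZero k] (v : Fin k → ℂ) (α : Fin k → ℝ) : Prop where
  pos : ∀ i, 0 < α i
  lt_pi : ∀ i, α i < Real.pi
  sum_eq : ∑ i, α i = Real.pi
  unit : ∀ i, ‖v i‖ = 1
  rotate : ∀ i, v (i + 1) = rot (α i + α (i + 1)) * v i

end Heis

open Topology Filter

namespace Heis

/-! The proof is a calibration argument. For a graph with gradient `G`, Gauss–Green turns the
integral of a horizontal divergence over the subgraph into a planar integral against `F = G + i z`.
Here `|F|` is the sub-Riemannian area density, and the characteristic points are those where `F =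
0`.

On the surfaces considered, the ruling halfline through almost every point has one of finitely many
unit directions `ρ j`, and `F = |F| i ρ j` there. Off the null set of axes, the direction at `z` is
the one maximizing `⟪ρ j, z⟫`. Hence the ruling field is the gradient of the convex function `max_j
⟪ρ j, z⟫`, and turning it by a right angle gives a divergence free field of modulus at most one.
Replacing the maximum by `n⁻¹ log ∑ exp (n ⟪ρ j, z⟫)` keeps both properties exactly and makes the
field smooth, so it can be cut off and used as a test field for any competitor. Letting `n → ∞`
recovers the area of the graph. This is `isAreaMinimizing_subgraph`.

In the coordinates `ξ + iη` of a wedge with axis `v i`, the surface is the graph of `-ξη + cot α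
η|η|`. On the border `ξ = cot α |η|` this function vanishes and its gradient is `i z`, an expression
that does not depend on the wedge. The pieces therefore glue to a `C¹` function with globally
Lipschitz gradient (`height_eq`, `gradient_eq`, `lipschitzWith_gradient`), which gives the
regularity of the normal and its value on the borders. The condition `∑ α i = π` makes the wedges,
of opening `2 α i`, fill the plane once (`exists_angle`, `re_eq_of_mem_wedge`, `exists_mem_wedge`).
-/

/-! ### Gauss–Green formula over the subgraph of a `C¹` function. -/

/-- The shear `(z, s) ↦ (z, s + u z)`. -/
def shear {u : ℂ → ℝ} (hu : Continuous u) : Heis ≃ₜ Heis where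
  toFun p := (p.1, p.2 + u p.1)
  invFun p := (p.1, p.2 - u p.1)
  left_inv p := by simp
  right_inv p := by simp
  continuous_toFun := by fun_prop
  continuous_invFun := by fun_prop

theorem measurePreserving_shear {u : ℂ → ℝ} (hu : Continuous u) :
    MeasurePreserving (shear hu) volume volume :=
  (MeasurePreserving.id (volume : Measure ℂ)).skew_product (g := fun z s => s + u z)
    (by fun_prop) (Filter.Eventually.of_forall fun z => map_add_right_eq_self volume (u z))

theorem setIntegral_subgraph {u : ℂ → ℝ} (hu : Continuous u) (g : Heis → ℝ) :
    ∫ p in subgraph u, g p = ∫ p in Set.univ ×ˢ Set.Iic (0 : ℝ), g (p.1, p.2 + u p.1) := by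
  rw [← (measurePreserving_shear hu).setIntegral_preimage_emb (shear hu).measurableEmbedding]
  congr 2
  ext p
  simp [shear, subgraph]

theorem integral_fderiv_eq_zero {E : Type*} [NormedAddCommGroup E] [NormedSpace ℝ E]
    [FiniteDimensional ℝ E] [MeasurableSpace E] [BorelSpace E] (μ : Measure E)
    [μ.IsAddHaarMeasure] {f : E → ℝ} (hf : ContDiff ℝ 1 f) (hc : HasCompactSupport f) (v : E) :
    ∫ x, fderiv ℝ f x v ∂μ = 0 := by
  have h := integral_mul_fderiv_eq_neg_fderiv_mul_of_integrable (μ := μ) (f := fun _ : E => (1 : ℝ))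
    (g := f) (v := v) (by simp) ?_ ?_ (by fun_prop) (fun x _ => hf.differentiable (by simp) x)
  · simpa using h
  · simp only [one_mul]
    exact ((hf.continuous_fderiv_apply (by simp)).comp
      (continuous_id.prodMk continuous_const)).integrable_of_hasCompactSupport
      (hc.fderiv_apply (𝕜 := ℝ) v)
  · simpa using hf.continuous.integrable_of_hasCompactSupport hc

theorem hasCompactSupport_shear {u : ℂ → ℝ} (hu : Continuous u) {a : Heis → ℝ}
    (hc : HasCompactSupport a) : HasCompactSupport (fun p : Heis => a (p.1, p.2 + u p.1)) :=
  hc.comp_homeomorph (shear hu)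

theorem hasCompactSupport_slice_left {a : Heis → ℝ} (hc : HasCompactSupport a) (s : ℝ) :
    HasCompactSupport (fun z : ℂ => a (z, s)) := by
  refine hc.comp_isClosedEmbedding (g := fun z : ℂ => ((z, s) : Heis))
    ⟨isEmbedding_prodMkLeft s, ?_⟩
  have : Set.range (fun z : ℂ => ((z, s) : Heis)) = {p | p.2 = s} := by
    ext ⟨z, t⟩; simp [eq_comm]
  rw [this]
  exact isClosed_eq continuous_snd continuous_const

theorem hasCompactSupport_slice_right {a : Heis → ℝ} (hc : HasCompactSupport a) (z : ℂ) :
    HasCompactSupport (fun s : ℝ => a (z, s)) :=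
  by
  refine hc.comp_isClosedEmbedding (g := fun s : ℝ => ((z, s) : Heis))
    ⟨isEmbedding_prodMkRight z, ?_⟩
  have : Set.range (fun s : ℝ => ((z, s) : Heis)) = {p | p.1 = z} := by
    ext ⟨w, t⟩; simp [eq_comm]
  rw [this]
  exact isClosed_eq continuous_fst continuous_const

/-- Integration of a derivative over the subgraph of `u`. -/
theorem integral_subgraph_fderiv {u : ℂ → ℝ} (hu : ContDiff ℝ 1 u) {a : Heis → ℝ}
    (ha : ContDiff ℝ 1 a) (hc : HasCompactSupport a) (e : ℂ) {c : ℂ → ℝ} (hcont : Continuous c) :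
    ∫ p in subgraph u, fderiv ℝ a p (e, c p.1) =
      -∫ z, a (z, u z) * (fderiv ℝ u z e - c z) := by
  set b : Heis → ℝ := fun p => a (p.1, p.2 + u p.1) with hb
  have hbc : HasCompactSupport b := hasCompactSupport_shear hu.continuous hc
  have hbd : ContDiff ℝ 1 b := by fun_prop
  have hud := hu.differentiable (by simp)
  have had := ha.differentiable (by simp)
  have hbdd := hbd.differentiable (by simp)
  set w : ℂ → ℝ := fun z => fderiv ℝ u z e - c z with hw
  have hwc : Continuous w := ((hu.continuous_fderiv_apply (by simp)).comp
      (continuous_id.prodMk continuous_const)).sub hcont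
  have hfd : ∀ (p : Heis) (v : Heis), fderiv ℝ b p v =
      fderiv ℝ a (p.1, p.2 + u p.1) (v.1, v.2 + fderiv ℝ u p.1 v.1) := by
    intro p v
    have h1 : HasFDerivAt (fun p : Heis => ((p.1, p.2 + u p.1) : Heis))
        ((ContinuousLinearMap.fst ℝ ℂ ℝ).prod (ContinuousLinearMap.snd ℝ ℂ ℝ +
          (fderiv ℝ u p.1).comp (ContinuousLinearMap.fst ℝ ℂ ℝ))) p :=
      hasFDerivAt_fst.prodMk (hasFDerivAt_snd.add ((hud p.1).hasFDerivAt.comp p hasFDerivAt_fst))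
    have h2 := (had (p.1, p.2 + u p.1)).hasFDerivAt.comp p h1
    have h3 : fderiv ℝ b p = _ := h2.fderiv
    rw [h3]
    simp
  -- After flattening the subgraph to a half-space, the direction `(e, c)` becomes `(e, -w)`: a part
  -- tangent to the slices and a vertical part.
  have hsplit : ∀ p : Heis, fderiv ℝ a (p.1, p.2 + u p.1) (e, c p.1) =
      fderiv ℝ b p (e, 0) - w p.1 * fderiv ℝ b p (0, 1) := by
    intro p
    rw [hfd, hfd]
    simp only [zero_add, map_zero, add_zero]
    rw [← smul_eq_mul, ← map_smul, ← map_sub]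
    congr 1
    simp [hw]
  rw [setIntegral_subgraph hu.continuous]
  simp only [hsplit]
  have hi1 : Integrable (fun p : Heis => fderiv ℝ b p (e, 0)) :=
    ((hbd.continuous_fderiv_apply (by simp)).comp
      (continuous_id.prodMk continuous_const)).integrable_of_hasCompactSupport
      (hbc.fderiv_apply (𝕜 := ℝ) _)
  have hi2 : Integrable (fun p : Heis => w p.1 * fderiv ℝ b p (0, 1)) :=
    ((hwc.comp continuous_fst).mul ((hbd.continuous_fderiv_apply (by simp)).comp
      (continuous_id.prodMk continuous_const))).integrable_of_hasCompactSupport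
      ((hbc.fderiv_apply (𝕜 := ℝ) _).mul_left)
  rw [integral_sub hi1.integrableOn hi2.integrableOn]
  have hvol : (volume : Measure Heis).restrict (Set.univ ×ˢ Set.Iic (0 : ℝ)) =
      (volume : Measure ℂ).prod (volume.restrict (Set.Iic (0 : ℝ))) := by
    rw [Measure.volume_eq_prod, ← Measure.prod_restrict, Measure.restrict_univ]
  -- Every horizontal slice contributes the integral of a derivative of a compactly supported
  -- function.
  have hz1 : ∫ p in Set.univ ×ˢ Set.Iic (0 : ℝ), fderiv ℝ b p (e, 0) = 0 := by
    have h1 := hi1.integrableOn (s := Set.univ ×ˢ Set.Iic (0 : ℝ))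
    rw [IntegrableOn, hvol] at h1
    rw [hvol, integral_prod_symm _ h1]
    have : ∀ s : ℝ, ∫ z : ℂ, fderiv ℝ b (z, s) (e, 0) = 0 := by
      intro s
      refine Eq.trans ?_ (integral_fderiv_eq_zero volume (f := fun z : ℂ => b (z, s)) (by fun_prop)
        (hasCompactSupport_slice_left hbc s) e)
      congr 1
      ext z
      have := (hbdd (z, s)).hasFDerivAt.comp z (f := fun z : ℂ => ((z, s) : Heis))
        (hasFDerivAt_prodMk_left z s)
      have h3 : fderiv ℝ (fun z : ℂ => b (z, s)) z = _ := this.fderiv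
      rw [h3]
      simp
    simp [this]
  -- On each vertical line the fundamental theorem of calculus leaves the value at the top, that is,
  -- on the graph.
  have hz2 : ∫ p in Set.univ ×ˢ Set.Iic (0 : ℝ), w p.1 * fderiv ℝ b p (0, 1) =
      ∫ z, a (z, u z) * w z := by
    have h1 := hi2.integrableOn (s := Set.univ ×ˢ Set.Iic (0 : ℝ))
    rw [IntegrableOn, hvol] at h1
    rw [hvol, integral_prod _ h1]
    congr 1
    ext z
    refine (integral_const_mul (w z) _).trans ?_
    rw [mul_comm]
    congr 1
    have h2 := HasCompactSupport.integral_Iic_deriv_eq (f := fun s : ℝ => b (z, s)) (by fun_prop)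
      (hasCompactSupport_slice_right hbc z) 0
    simp only [hb, zero_add] at h2
    rw [← h2]
    congr 1
    ext s
    have := (hbdd (z, s)).hasFDerivAt.comp s (f := fun s : ℝ => ((z, s) : Heis))
      (hasFDerivAt_prodMk_right z s)
    have h3 : fderiv ℝ (fun s : ℝ => b (z, s)) s = _ := this.fderiv
    change _ = deriv (fun s : ℝ => b (z, s)) s
    rw [← fderiv_apply_one_eq_deriv, h3]
    simp
  rw [hz1, hz2, zero_sub]

theorem X_eq (p : Heis) : X p = (1, p.1.im) := rfl

theorem Y_eq (p : Heis) : Y p = (Complex.I, -p.1.re) := rfl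

/-- The Gauss–Green formula for horizontal fields over the subgraph of `u`; here `G` is the
gradient of `u`. -/
theorem integral_subgraph_horizontalDiv {u : ℂ → ℝ} {G : ℂ → ℂ} (hu : ContDiff ℝ 1 u)
    (hG : ∀ z, HasFDerivAt u (innerSL ℝ (G z)) z) (hGc : Continuous G) {a b : Heis → ℝ}
    (ha : ContDiff ℝ 1 a) (hb : ContDiff ℝ 1 b) (hac : HasCompactSupport a)
    (hbc : HasCompactSupport b) :
    ∫ p in subgraph u, horizontalDiv a b p =
      -∫ z, (a (z, u z) * (G z + Complex.I * z).re + b (z, u z) * (G z + Complex.I * z).im) := by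
  have huc := hu.continuous
  have hX : Continuous fun p : Heis => fderiv ℝ a p (1, p.1.im) :=
    (ha.continuous_fderiv_apply (by simp)).comp (continuous_id.prodMk
      (continuous_const.prodMk (by fun_prop)))
  have hY : Continuous fun p : Heis => fderiv ℝ b p (Complex.I, -p.1.re) :=
    (hb.continuous_fderiv_apply (by simp)).comp (continuous_id.prodMk
      (continuous_const.prodMk (by fun_prop)))
  have hXi : Integrable fun p : Heis => fderiv ℝ a p (1, p.1.im) :=
    hX.integrable_of_hasCompactSupport ((hac.fderiv ℝ).mono' (by
      refine subset_trans ?_ subset_closure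
      intro p hp; contrapose! hp; simp at hp ⊢; simp [hp]))
  have hYi : Integrable fun p : Heis => fderiv ℝ b p (Complex.I, -p.1.re) :=
    hY.integrable_of_hasCompactSupport ((hbc.fderiv ℝ).mono' (by
      refine subset_trans ?_ subset_closure
      intro p hp; contrapose! hp; simp at hp ⊢; simp [hp]))
  have hcs : ∀ {f : Heis → ℝ}, ContDiff ℝ 1 f → HasCompactSupport f →
      ∀ {g : ℂ → ℝ}, Continuous g → Integrable fun z : ℂ => f (z, u z) * g z := by
    intro f hf hfc g hg
    have h1 := hasCompactSupport_slice_left (hasCompactSupport_shear huc hfc) 0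
    simp only [zero_add] at h1
    have := hf.continuous
    exact Continuous.integrable_of_hasCompactSupport (by fun_prop) h1.mul_right
  simp only [horizontalDiv, X_eq, Y_eq]
  rw [integral_add hXi.integrableOn hYi.integrableOn,
    integral_subgraph_fderiv hu ha hac 1 (c := fun z => z.im) (by fun_prop),
    integral_subgraph_fderiv hu hb hbc Complex.I (c := fun z => -z.re) (by fun_prop),
    ← neg_add, ← integral_add]
  · simp only [(hG _).fderiv]
    congr 2
    ext z
    simp [Complex.inner, sub_eq_add_neg]
  · simp only [(hG _).fderiv]
    exact hcs ha hac (by fun_prop)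
  · simp only [(hG _).fderiv]
    exact hcs hb hbc (by fun_prop)

/-! Softmax approximation of a support function -/

section Softmax

variable {ι : Type*} [Fintype ι] (ρ : ι → ℂ) (n : ℝ)

/-- `∑ j, c j * exp (n ⟪ρ j, z⟫)`. -/
noncomputable def expSum (c : ι → ℝ) (z : ℂ) : ℝ :=
  ∑ j, c j * Real.exp (n * ((ρ j).re * z.re + (ρ j).im * z.im))

/-- The gradient of `n⁻¹ log (∑ j, exp (n ⟪ρ j, z⟫))`. -/
noncomputable def softmax (z : ℂ) : ℂ :=
  ⟨expSum ρ n (fun j => (ρ j).re) z / expSum ρ n (fun _ => 1) z,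
    expSum ρ n (fun j => (ρ j).im) z / expSum ρ n (fun _ => 1) z⟩

theorem contDiff_expSum (c : ι → ℝ) : ContDiff ℝ 1 (expSum ρ n c) := by
  have h1 : ContDiff ℝ 1 (fun z : ℂ => z.re) := Complex.reCLM.contDiff
  have h2 : ContDiff ℝ 1 (fun z : ℂ => z.im) := Complex.imCLM.contDiff
  unfold expSum
  fun_prop

theorem expSum_one_pos [Nonempty ι] (z : ℂ) : 0 < expSum ρ n (fun _ => 1) z :=
  Finset.sum_pos (fun _ _ => by positivity) Finset.univ_nonempty

theorem fderiv_expSum (c : ι → ℝ) (z h : ℂ) : fderiv ℝ (expSum ρ n c) z h =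
    n * (h.re * expSum ρ n (fun j => c j * (ρ j).re) z +
      h.im * expSum ρ n (fun j => c j * (ρ j).im) z) := by
  have hj : ∀ j ∈ Finset.univ, HasFDerivAt
      (fun z : ℂ => c j * Real.exp (n * ((ρ j).re * z.re + (ρ j).im * z.im)))
      (c j • (Real.exp (n * ((ρ j).re * z.re + (ρ j).im * z.im)) •
        (n • ((ρ j).re • Complex.reCLM + (ρ j).im • Complex.imCLM)))) z := fun j _ =>
    ((((Complex.reCLM.hasFDerivAt.const_mul _).add
      (Complex.imCLM.hasFDerivAt.const_mul _)).const_mul n).exp).const_mul (c j)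
  have h1 : HasFDerivAt (expSum ρ n c) _ z := HasFDerivAt.fun_sum hj
  rw [h1.fderiv]
  simp only [expSum, _root_.sum_apply, Finset.mul_sum, ← Finset.sum_add_distrib]
  refine Finset.sum_congr rfl fun j _ => ?_
  simp
  ring

theorem contDiff_softmax_re [Nonempty ι] : ContDiff ℝ 1 fun z => (softmax ρ n z).re :=
  (contDiff_expSum ρ n _).div (contDiff_expSum ρ n _) fun z => (expSum_one_pos ρ n z).ne'

theorem contDiff_softmax_im [Nonempty ι] : ContDiff ℝ 1 fun z => (softmax ρ n z).im :=
  (contDiff_expSum ρ n _).div (contDiff_expSum ρ n _) fun z => (expSum_one_pos ρ n z).ne'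

/-- The field `softmax ρ n` is curl free. -/
theorem fderiv_softmax_symm [Nonempty ι] (z : ℂ) :
    fderiv ℝ (fun z => (softmax ρ n z).im) z 1 =
      fderiv ℝ (fun z => (softmax ρ n z).re) z Complex.I := by
  have hd : ∀ c, DifferentiableAt ℝ (expSum ρ n c) z := fun c =>
    (contDiff_expSum ρ n c).differentiable (by simp) z
  have h0 := (expSum_one_pos ρ n z).ne'
  have e : ∀ c, fderiv ℝ (fun z => expSum ρ n c z * (expSum ρ n (fun _ => 1) z)⁻¹) z = _ :=
    fun c => ((hd c).hasFDerivAt.mul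
      ((hasDerivAt_inv h0).comp_hasFDerivAt z (hd _).hasFDerivAt)).fderiv
  simp only [softmax, div_eq_mul_inv, e]
  simp [fderiv_expSum]
  simp_rw [mul_comm (ρ _).re]
  ring

theorem softmax_eq (z : ℂ) : softmax ρ n z = ∑ j, (Real.exp (n * ((ρ j).re * z.re +
    (ρ j).im * z.im)) / expSum ρ n (fun _ => 1) z) • ρ j := by
  apply Complex.ext
  · simp only [softmax, Complex.re_sum, Complex.smul_re, smul_eq_mul]
    rw [expSum, Finset.sum_div]
    exact Finset.sum_congr rfl fun j _ => by ring
  · simp only [softmax, Complex.im_sum, Complex.smul_im, smul_eq_mul]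
    rw [expSum, Finset.sum_div]
    exact Finset.sum_congr rfl fun j _ => by ring

theorem sum_weights [Nonempty ι] (z : ℂ) : ∑ j, Real.exp (n * ((ρ j).re * z.re +
    (ρ j).im * z.im)) / expSum ρ n (fun _ => 1) z = 1 := by
  rw [← Finset.sum_div, div_eq_one_iff_eq (expSum_one_pos ρ n z).ne']
  simp [expSum]

theorem norm_softmax_le [Nonempty ι] (hρ : ∀ j, ‖ρ j‖ = 1) (z : ℂ) : ‖softmax ρ n z‖ ≤ 1 := by
  rw [softmax_eq]
  refine (norm_sum_le _ _).trans ((sum_weights ρ n z).le.trans' <| Finset.sum_le_sum fun j _ => ?_)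
  have := expSum_one_pos ρ n z
  rw [norm_smul, hρ, mul_one, Real.norm_of_nonneg (by positivity)]

/-- The weight of a non-maximal direction decays like `exp (n d)` with `d < 0`. Comparing directions
instead of indices in `hi` allows several indices with the same maximizing direction. -/
theorem tendsto_softmax [Nonempty ι] {z : ℂ} {i : ι}
    (hi : ∀ j, ρ j = ρ i ∨
      (ρ j).re * z.re + (ρ j).im * z.im < (ρ i).re * z.re + (ρ i).im * z.im) :
    Tendsto (fun n : ℕ => softmax ρ n z) atTop (𝓝 (ρ i)) := by
  have h1 : ∀ n : ℕ, softmax ρ n z = ρ i + ∑ j, (Real.exp (n * ((ρ j).re * z.re +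
      (ρ j).im * z.im)) / expSum ρ n (fun _ => 1) z) • (ρ j - ρ i) := by
    intro n
    simp only [smul_sub, Finset.sum_sub_distrib, ← Finset.sum_smul, sum_weights, one_smul,
      softmax_eq]
    ring
  simp only [h1]
  rw [show 𝓝 (ρ i) = 𝓝 (ρ i + ∑ j : ι, (0 : ℂ)) by simp]
  refine tendsto_const_nhds.add (tendsto_finsetSum _ fun j _ => ?_)
  rcases hi j with h | h
  · simp [h]
  rw [show (0 : ℂ) = (0 : ℝ) • (ρ j - ρ i) by simp]
  refine Tendsto.smul_const ?_ _
  set d := (ρ j).re * z.re + (ρ j).im * z.im - ((ρ i).re * z.re + (ρ i).im * z.im) with hd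
  have hexp : Tendsto (fun n : ℕ => Real.exp (n * d)) atTop (𝓝 0) :=
    Real.tendsto_exp_atBot.comp
      (tendsto_natCast_atTop_atTop.atTop_mul_const_of_neg (sub_neg.2 h))
  refine squeeze_zero (fun n => ?_) (fun n => ?_) hexp
  · have := expSum_one_pos ρ n z
    positivity
  · rw [div_le_iff₀ (expSum_one_pos ρ n z)]
    have h2 : Real.exp (n * ((ρ i).re * z.re + (ρ i).im * z.im)) ≤ expSum ρ n (fun _ => 1) z := by
      have := Finset.single_le_sum (f := fun j => 1 * Real.exp (n * ((ρ j).re * z.re +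
        (ρ j).im * z.im))) (fun j _ => by positivity) (Finset.mem_univ i)
      simpa [expSum] using this
    calc _ = Real.exp (n * d) * Real.exp (n * ((ρ i).re * z.re + (ρ i).im * z.im)) := by
          rw [← Real.exp_add, hd]; ring_nf
      _ ≤ _ := by gcongr

end Softmax

/-! Calibration -/

/-- The value 1 is taken on a neighbourhood of each point of `K`, so that derivatives of `χ` also
vanish on `K`. -/
theorem exists_cutoff {K Ω : Set Heis} (hK : IsCompact K) (hΩ : IsOpen Ω) (h : K ⊆ Ω) :
    ∃ χ : Heis → ℝ, ContDiff ℝ 1 χ ∧ (∀ p, 0 ≤ χ p ∧ χ p ≤ 1) ∧ HasCompactSupport χ ∧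
      tsupport χ ⊆ Ω ∧ ∀ p ∈ K, χ =ᶠ[𝓝 p] 1 := by
  obtain ⟨V, hV, hKV, hVΩ, hVc⟩ := exists_open_between_and_isCompact_closure hK hΩ h
  obtain ⟨f, h0, h1, hf⟩ := exists_contMDiffMap_zero_one_nhds_of_isClosed
    (modelWithCornersSelf ℝ Heis) (n := 1) hV.isClosed_compl hK.isClosed
    (Set.disjoint_left.2 fun x hx hxK => hx (hKV hxK))
  have hs : tsupport f ⊆ closure V := by
    refine closure_mono fun x hx => ?_
    by_contra hxV
    exact hx (h0.self_of_nhdsSet x hxV)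
  refine ⟨f, f.contMDiff.contDiff, hf, hVc.of_isClosed_subset (isClosed_tsupport _) hs,
    hs.trans hVΩ, fun p hp => ?_⟩
  exact (eventually_nhdsSet_iff_forall.1 h1) p hp

theorem horizontalDiv_of_notMem_tsupport {a b : Heis → ℝ} {p : Heis} (ha : p ∉ tsupport a)
    (hb : p ∉ tsupport b) : horizontalDiv a b p = 0 := by
  simp [horizontalDiv, fderiv_of_notMem_tsupport (𝕜 := ℝ) ha,
    fderiv_of_notMem_tsupport (𝕜 := ℝ) hb]

theorem setIntegral_inter_horizontalDiv {E Ω : Set Heis} (hE : MeasurableSet E)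
    {a b : Heis → ℝ} (h : IsTestField Ω a b) :
    ∫ p in E ∩ Ω, horizontalDiv a b p = ∫ p in E, horizontalDiv a b p := by
  refine Eq.symm <| setIntegral_eq_of_subset_of_forall_sdiff_eq_zero hE Set.inter_subset_left fun p hp => ?_
  have hp' : p ∉ Ω := fun h' => hp.2 ⟨hp.1, h'⟩
  exact horizontalDiv_of_notMem_tsupport (fun h' => hp' (h.supp_fst h'))
    (fun h' => hp' (h.supp_snd h'))

theorem setIntegral_congr_of_diff_eq {E F Ω K : Set Heis} (hE : NullMeasurableSet E volume)
    (hF : NullMeasurableSet F volume) (hΩ : IsOpen Ω) (hEF : E \ K = F \ K) {f : Heis → ℝ}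
    (hf : ∀ p ∈ K, f p = 0) : ∫ p in F ∩ Ω, f p = ∫ p in E ∩ Ω, f p := by
  have hΩ' := hΩ.measurableSet.nullMeasurableSet (μ := (volume : Measure Heis))
  rw [← integral_indicator₀ (hF.inter hΩ'), ← integral_indicator₀ (hE.inter hΩ')]
  refine integral_congr_ae (.of_forall fun p => ?_)
  change (F ∩ Ω).indicator f p = (E ∩ Ω).indicator f p
  by_cases hp : p ∈ K
  · have h0 : ∀ S : Set Heis, S.indicator f p = 0 := fun S => by
      by_cases hS : p ∈ S
      · rw [Set.indicator_of_mem hS, hf p hp]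
      · rw [Set.indicator_of_notMem hS]
    rw [h0, h0]
  · have : p ∈ E ↔ p ∈ F := by
      have := Set.ext_iff.1 hEF p
      simpa [hp] using this
    by_cases hS : p ∈ E ∩ Ω
    · rw [Set.indicator_of_mem hS, Set.indicator_of_mem (show p ∈ F ∩ Ω from ⟨this.1 hS.1, hS.2⟩)]
    · rw [Set.indicator_of_notMem hS, Set.indicator_of_notMem fun h => hS ⟨this.2 h.1, h.2⟩]

theorem le_perimeter {E Ω : Set Heis} {a b : Heis → ℝ} (h : IsTestField Ω a b) :
    ENNReal.ofReal (∫ p in E ∩ Ω, horizontalDiv a b p) ≤ perimeter E Ω :=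
  le_iSup_of_le a (le_iSup_of_le b (le_iSup_of_le h le_rfl))

section Calibration

variable {u : ℂ → ℝ} {G : ℂ → ℂ}

theorem integrable_graph (hu : Continuous u) {χ : Heis → ℝ} (hχ : Continuous χ)
    (hc : HasCompactSupport χ) {g : ℂ → ℝ} (hg : Continuous g) :
    Integrable fun z : ℂ => χ (z, u z) * g z := by
  have h1 := hasCompactSupport_slice_left (hasCompactSupport_shear hu hc) 0
  simp only [zero_add] at h1
  exact Continuous.integrable_of_hasCompactSupport (by fun_prop) h1.mul_right

theorem contDiff_of_gradient (hG : ∀ z, HasFDerivAt u (innerSL ℝ (G z)) z) (hGc : Continuous G) :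
    ContDiff ℝ 1 u := by
  rw [contDiff_one_iff_hasFDerivAt]
  exact ⟨fun z => innerSL ℝ (G z), (innerSL ℝ).continuous.comp hGc, hG⟩

/-- The perimeter of a subgraph is bounded by the area integral of the graph. -/
theorem integral_horizontalDiv_le (hG : ∀ z, HasFDerivAt u (innerSL ℝ (G z)) z)
    (hGc : Continuous G) {Ω : Set Heis} {a b χ : Heis → ℝ} (h : IsTestField Ω a b)
    (hχ : ContDiff ℝ 1 χ) (hχ0 : ∀ p, 0 ≤ χ p) (hχc : HasCompactSupport χ)
    (hχ1 : ∀ p ∈ tsupport a ∪ tsupport b, χ p = 1) :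
    ∫ p in subgraph u, horizontalDiv a b p ≤ ∫ z, χ (z, u z) * ‖G z + Complex.I * z‖ := by
  have hu := contDiff_of_gradient hG hGc
  rw [integral_subgraph_horizontalDiv hu hG hGc h.contDiff_fst h.contDiff_snd h.compact_fst
    h.compact_snd, ← integral_neg]
  have hF : Continuous fun z => G z + Complex.I * z := by fun_prop
  refine integral_mono ?_ (integrable_graph hu.continuous hχ.continuous hχc hF.norm) fun z => ?_
  · exact ((integrable_graph hu.continuous h.contDiff_fst.continuous h.compact_fst
      (Complex.continuous_re.comp hF)).add (integrable_graph hu.continuous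
        h.contDiff_snd.continuous h.compact_snd (Complex.continuous_im.comp hF))).neg
  · by_cases hp : (z, u z) ∈ tsupport a ∪ tsupport b
    -- Cauchy–Schwarz between `(a, b)`, of modulus at most one, and `F`.
    · simp only [hχ1 _ hp, one_mul]
      set F := G z + Complex.I * z
      refine (neg_le_abs _).trans (abs_le_of_sq_le_sq ?_ (norm_nonneg _))
      rw [Complex.sq_norm, Complex.normSq_apply]
      nlinarith [h.modulus_le (z, u z), sq_nonneg (a (z, u z) * F.im - b (z, u z) * F.re),
        mul_nonneg (sub_nonneg.2 (h.modulus_le (z, u z))) (add_nonneg (sq_nonneg F.re)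
          (sq_nonneg F.im))]
    · rw [Set.mem_union, not_or] at hp
      simp only [image_eq_zero_of_notMem_tsupport hp.1, image_eq_zero_of_notMem_tsupport hp.2,
        zero_mul, add_zero, neg_zero]
      exact mul_nonneg (hχ0 _) (norm_nonneg _)

theorem isClosed_subgraph (hu : Continuous u) : IsClosed (subgraph u) :=
  isClosed_le continuous_snd (hu.comp continuous_fst)

theorem hasLocallyFinitePerimeter_subgraph (hG : ∀ z, HasFDerivAt u (innerSL ℝ (G z)) z)
    (hGc : Continuous G) : HasLocallyFinitePerimeter (subgraph u) := by
  have hm := (isClosed_subgraph (contDiff_of_gradient hG hGc).continuous).measurableSet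
  refine ⟨hm.nullMeasurableSet, fun Ω _ hb => ?_⟩
  obtain ⟨χ, hχ, hχ0, hχc, -, hχ1⟩ := exists_cutoff hb.isCompact_closure isOpen_univ
    (Set.subset_univ _)
  refine lt_of_le_of_lt (iSup_le fun a => iSup_le fun b => iSup_le fun h => ?_)
    (ENNReal.ofReal_lt_top (r := ∫ z, χ (z, u z) * ‖G z + Complex.I * z‖))
  rw [setIntegral_inter_horizontalDiv hm h]
  refine ENNReal.ofReal_le_ofReal (integral_horizontalDiv_le hG hGc h hχ (fun p => (hχ0 p).1) hχc
    fun p hp => (hχ1 p (subset_closure ?_)).eq_of_nhds)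
  exact hp.elim (fun h' => h.supp_fst h') (fun h' => h.supp_snd h')

variable {ι : Type*} [Fintype ι] [Nonempty ι] {ρ : ι → ℂ}

/-- The calibrating field cut off by `χ` is a test field. -/
theorem isTestField_softmax (hρ : ∀ j, ‖ρ j‖ = 1) {Ω : Set Heis} {χ : Heis → ℝ}
    (hχ : ContDiff ℝ 1 χ) (hχ0 : ∀ p, 0 ≤ χ p ∧ χ p ≤ 1) (hχc : HasCompactSupport χ)
    (hχΩ : tsupport χ ⊆ Ω) (n : ℝ) :
    IsTestField Ω (fun p => χ p * (softmax ρ n p.1).im) (fun p => χ p * -(softmax ρ n p.1).re) where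
  contDiff_fst := hχ.mul ((contDiff_softmax_im ρ n).comp contDiff_fst)
  contDiff_snd := hχ.mul ((contDiff_softmax_re ρ n).comp contDiff_fst).neg
  modulus_le p := by
    have h1 := norm_softmax_le ρ n hρ p.1
    have h2 : ‖softmax ρ n p.1‖ ^ 2 ≤ 1 := pow_le_one₀ (norm_nonneg _) h1
    rw [Complex.sq_norm, Complex.normSq_apply] at h2
    have h3 : χ p ^ 2 ≤ 1 := pow_le_one₀ (hχ0 p).1 (hχ0 p).2
    nlinarith [sq_nonneg (χ p), mul_le_mul_of_nonneg_left h2 (sq_nonneg (χ p))]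
  compact_fst := hχc.mul_right
  compact_snd := hχc.mul_right
  supp_fst := (tsupport_mul_subset_left).trans hχΩ
  supp_snd := (tsupport_mul_subset_left).trans hχΩ

/-- The field does not depend on `t`, so its horizontal divergence is the planar divergence of `-i`
times a gradient, which vanishes because gradients are curl free. -/
theorem horizontalDiv_softmax {χ : Heis → ℝ} (n : ℝ) {p : Heis} (hp : χ =ᶠ[𝓝 p] 1) :
    horizontalDiv (fun p => χ p * (softmax ρ n p.1).im) (fun p => χ p * -(softmax ρ n p.1).re) p
      = 0 := by
  have h1 : (fun p : Heis => χ p * (softmax ρ n p.1).im) =ᶠ[𝓝 p]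
      fun p => (softmax ρ n p.1).im := by
    filter_upwards [hp] with q hq; simp [hq]
  have h2 : (fun p : Heis => χ p * -(softmax ρ n p.1).re) =ᶠ[𝓝 p]
      fun p => -(softmax ρ n p.1).re := by
    filter_upwards [hp] with q hq; simp [hq]
  have e1 : fderiv ℝ (fun p : Heis => (softmax ρ n p.1).im) p = _ :=
    (((contDiff_softmax_im ρ n).differentiable (by simp) p.1).hasFDerivAt.comp p
      hasFDerivAt_fst).fderiv
  have e2 : fderiv ℝ (fun p : Heis => -(softmax ρ n p.1).re) p = _ :=
    (((contDiff_softmax_re ρ n).differentiable (by simp) p.1).hasFDerivAt.comp p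
      hasFDerivAt_fst).neg.fderiv
  rw [horizontalDiv, h1.fderiv_eq, h2.fderiv_eq, e1, e2]
  simp [X, Y, fderiv_softmax_symm]

/-- By Gauss–Green the integral is that of `χ ⟪i softmax, F⟫`. It is dominated by `χ |F|`, and
converges almost everywhere to `χ ⟪i ρ i, F⟫ = χ |F|`. -/
theorem tendsto_integral_softmax (hρ : ∀ j, ‖ρ j‖ = 1)
    (hG : ∀ z, HasFDerivAt u (innerSL ℝ (G z)) z) (hGc : Continuous G)
    (hcal : ∀ᵐ z : ℂ, ∃ i, (∀ j, ρ j = ρ i ∨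
      (ρ j).re * z.re + (ρ j).im * z.im < (ρ i).re * z.re + (ρ i).im * z.im) ∧
      G z + Complex.I * z = ‖G z + Complex.I * z‖ • (Complex.I * ρ i))
    {Ω : Set Heis} {χ : Heis → ℝ}
    (hχ : ContDiff ℝ 1 χ) (hχ0 : ∀ p, 0 ≤ χ p ∧ χ p ≤ 1) (hχc : HasCompactSupport χ)
    (hχΩ : tsupport χ ⊆ Ω) :
    Tendsto (fun n : ℕ => ∫ p in subgraph u, horizontalDiv
      (fun p => χ p * (softmax ρ n p.1).im) (fun p => χ p * -(softmax ρ n p.1).re) p) atTop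
      (𝓝 (∫ z, χ (z, u z) * ‖G z + Complex.I * z‖)) := by
  have hu := contDiff_of_gradient hG hGc
  have huc := hu.continuous
  have hF : Continuous fun z => G z + Complex.I * z := by fun_prop
  have e : ∀ n : ℕ, ∫ p in subgraph u, horizontalDiv
      (fun p => χ p * (softmax ρ n p.1).im) (fun p => χ p * -(softmax ρ n p.1).re) p =
      ∫ z, χ (z, u z) * ((softmax ρ n z).re * (G z + Complex.I * z).im -
        (softmax ρ n z).im * (G z + Complex.I * z).re) := by
    intro n
    have h := isTestField_softmax (Ω := Ω) hρ hχ hχ0 hχc hχΩ n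
    rw [integral_subgraph_horizontalDiv hu hG hGc h.contDiff_fst h.contDiff_snd h.compact_fst
      h.compact_snd, ← integral_neg]
    congr 1
    ext z
    ring
  simp only [e]
  refine tendsto_integral_of_dominated_convergence _ (fun n => ?_)
    (integrable_graph huc hχ.continuous hχc hF.norm) (fun n => .of_forall fun z => ?_) ?_
  · have h1 := (contDiff_softmax_re ρ n).continuous
    have h2 := (contDiff_softmax_im ρ n).continuous
    have h3 := hχ.continuous
    have h4 := Complex.continuous_re.comp hF
    have h5 := Complex.continuous_im.comp hF
    exact Continuous.aestronglyMeasurable ((by fun_prop : Continuous fun z => χ (z, u z)).mul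
      ((h1.mul h5).sub (h2.mul h4)))
  · rw [norm_mul, Real.norm_of_nonneg (hχ0 _).1]
    refine mul_le_mul_of_nonneg_left ?_ (hχ0 _).1
    set F := G z + Complex.I * z
    have h1 := norm_softmax_le ρ n hρ z
    have : (softmax ρ n z).re * F.im - (softmax ρ n z).im * F.re =
        (starRingEnd ℂ (softmax ρ n z) * F).im := by simp; ring
    rw [this]
    refine (Complex.abs_im_le_norm _).trans ?_
    rw [norm_mul, RCLike.norm_conj]
    exact mul_le_of_le_one_left (norm_nonneg _) h1
  · filter_upwards [hcal] with z ⟨i, hi, hz⟩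
    have h1 := tendsto_softmax ρ hi
    have h2 := (Complex.continuous_re.tendsto _).comp h1
    have h3 := (Complex.continuous_im.tendsto _).comp h1
    have h4 : (ρ i).re * (G z + Complex.I * z).im - (ρ i).im * (G z + Complex.I * z).re =
        ‖G z + Complex.I * z‖ := by
      have h5 : (ρ i).re ^ 2 + (ρ i).im ^ 2 = 1 := by
        have := Complex.sq_norm (ρ i)
        rw [hρ, Complex.normSq_apply] at this
        linarith
      rw [hz, norm_smul]
      simp only [Complex.smul_re, Complex.smul_im, Complex.mul_re, Complex.mul_im, Complex.I_re,
        Complex.I_im, smul_eq_mul, norm_mul, hρ, Complex.norm_I, norm_norm]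
      linear_combination ‖G z + Complex.I * z‖ * h5
    have h5 := (((h2.mul_const (G z + Complex.I * z).im).sub
      (h3.mul_const (G z + Complex.I * z).re)).const_mul (χ (z, u z)))
    rw [h4] at h5
    exact h5

/-- A subgraph whose horizontal normal is calibrated by the gradient of the support function
`z ↦ max_j ⟪ρ j, z⟫`, turned by a right angle, is area-minimizing. -/
theorem isAreaMinimizing_subgraph (hρ : ∀ j, ‖ρ j‖ = 1)
    (hG : ∀ z, HasFDerivAt u (innerSL ℝ (G z)) z) (hGc : Continuous G)
    (hcal : ∀ᵐ z : ℂ, ∃ i, (∀ j, ρ j = ρ i ∨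
      (ρ j).re * z.re + (ρ j).im * z.im < (ρ i).re * z.re + (ρ i).im * z.im) ∧
      G z + Complex.I * z = ‖G z + Complex.I * z‖ • (Complex.I * ρ i)) :
    IsAreaMinimizing (subgraph u) := by
  have hE := hasLocallyFinitePerimeter_subgraph hG hGc
  have hm := (isClosed_subgraph (contDiff_of_gradient hG hGc).continuous).measurableSet
  refine ⟨hE, fun Ω hΩ _ F hF ⟨K, hK, hKΩ, hEF⟩ => ?_⟩
  refine iSup_le fun a => iSup_le fun b => iSup_le fun h => ?_
  -- With `χ = 1` near `K`, the cut-off calibration is divergence free on `K` and cannot distinguish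
  -- `E` from `F`. With `χ = 1` on the supports of `a` and `b`, the integral of `χ |G + i z|` over
  -- the graph bounds what `(a, b)` can detect.
  obtain ⟨χ, hχ, hχ0, hχc, hχΩ, hχ1⟩ := exists_cutoff
    (hK.union (h.compact_fst.isCompact.union h.compact_snd.isCompact)) hΩ
    (Set.union_subset hKΩ (Set.union_subset h.supp_fst h.supp_snd))
  rw [setIntegral_inter_horizontalDiv hm h]
  refine (ENNReal.ofReal_le_ofReal (integral_horizontalDiv_le hG hGc h hχ (fun p => (hχ0 p).1) hχc
    fun p hp => (hχ1 p (Or.inr hp)).eq_of_nhds)).trans ?_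
  -- It suffices that each approximate calibration has integral over `E` at most the perimeter of
  -- `F`. That integral equals the one over `F`, for which the field is admissible.
  refine le_of_tendsto' (ENNReal.tendsto_ofReal
    (tendsto_integral_softmax hρ hG hGc hcal hχ hχ0 hχc hχΩ)) fun n => ?_
  have ht := isTestField_softmax (Ω := Ω) hρ hχ hχ0 hχc hχΩ n
  rw [← setIntegral_inter_horizontalDiv hm ht,
    ← setIntegral_congr_of_diff_eq hE.1 hF hΩ hEF fun p hp =>
      horizontalDiv_softmax n (hχ1 p (Or.inl hp))]
  exact le_perimeter ht

end Calibration

/-! Regularity of graphs with Lipschitz gradient -/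

section Regularity

variable {u : ℂ → ℝ} {G : ℂ → ℂ}

/-- `ζ.re X + ζ.im Y - T`, normalized, at a point over `z`. -/
noncomputable def downwardUnit (q : ℂ × ℂ) : Heis :=
  (Real.sqrt (1 + q.1.re ^ 2 + q.1.im ^ 2))⁻¹ • (q.1, q.1.re * q.2.im - q.1.im * q.2.re - 1)

theorem contDiff_downwardUnit : ContDiff ℝ 1 downwardUnit := by
  have h1 : ContDiff ℝ 1 (fun q : ℂ × ℂ => q.1.re) := Complex.reCLM.contDiff.comp contDiff_fst
  have h2 : ContDiff ℝ 1 (fun q : ℂ × ℂ => q.1.im) := Complex.imCLM.contDiff.comp contDiff_fst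
  have h3 : ContDiff ℝ 1 (fun q : ℂ × ℂ => q.2.re) := Complex.reCLM.contDiff.comp contDiff_snd
  have h4 : ContDiff ℝ 1 (fun q : ℂ × ℂ => q.2.im) := Complex.imCLM.contDiff.comp contDiff_snd
  have hpos : ∀ q : ℂ × ℂ, 0 < 1 + q.1.re ^ 2 + q.1.im ^ 2 := fun q => by positivity
  have h5 : ContDiff ℝ 1 (fun q : ℂ × ℂ => Real.sqrt (1 + q.1.re ^ 2 + q.1.im ^ 2)) :=
    ((contDiff_const.add (h1.pow 2)).add (h2.pow 2)).sqrt fun q => (hpos q).ne'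
  exact (h5.inv fun q => (Real.sqrt_pos.2 (hpos q)).ne').smul
    (contDiff_fst.prodMk (((h1.mul h4).sub (h2.mul h3)).sub contDiff_const))

/-- In the frame `X, Y, T` the downward normal is `(F, -1)` normalized, a smooth function of `F = G
+ i z` and `z`. Where `G = i z` one has `F = 2 i z`, which produces the rotation normal. -/
theorem exists_unitNormalField {K : ℝ≥0} (hG : ∀ z, HasFDerivAt u (innerSL ℝ (G z)) z)
    (hGL : LipschitzWith K G) {R : Set ℂ} (hR : ∀ z ∈ R, G z = Complex.I * z) :
    ∃ N : Heis → Heis, IsUnitNormalField u N ∧ ContinuousOn N (tGraph u) ∧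
      LocallyLipschitzOn (tGraph u) N ∧ ∀ z ∈ R, N (z, u z) = rotationNormal (z, u z) := by
  have hlip : LocallyLipschitz fun p : Heis => downwardUnit (G p.1 + Complex.I * p.1, p.1) := by
    have h0 : LipschitzWith 1 (fun p : Heis => p.1) := LipschitzWith.prod_fst
    have h1 : LipschitzWith (K * 1) (fun p : Heis => G p.1) := hGL.comp h0
    have h2 : LipschitzWith _ (fun p : Heis => Complex.I * p.1) :=
      ((ContinuousLinearMap.mul ℝ ℂ Complex.I).comp
        (ContinuousLinearMap.fst ℝ ℂ ℝ)).lipschitz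
    exact contDiff_downwardUnit.locallyLipschitz.comp
      ((h1.add h2).prodMk h0).locallyLipschitz
  refine ⟨_, ?_, hlip.continuous.continuousOn, hlip.locallyLipschitzOn, ?_⟩
  · intro p hp
    set F := G p.1 + Complex.I * p.1 with hF
    have hFre : (G p.1).re = F.re + p.1.im := by simp [hF]
    have hFim : (G p.1).im = F.im - p.1.re := by simp [hF]
    have hpos : 0 < 1 + F.re ^ 2 + F.im ^ 2 := by positivity
    have hs := Real.sq_sqrt hpos.le
    have hsp := Real.sqrt_pos.2 hpos
    set s := Real.sqrt (1 + F.re ^ 2 + F.im ^ 2) with hs'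
    have hN : downwardUnit (F, p.1) = (s⁻¹ • F, s⁻¹ * (F.re * p.1.im - F.im * p.1.re - 1)) := rfl
    simp only [← hF, hN]
    refine ⟨?_, fun V hV => ?_, ?_⟩
    · simp only [metric, omega, LinearMap.coe_mk, AddHom.coe_mk, Complex.smul_re, Complex.smul_im,
        smul_eq_mul]
      field_simp
      linear_combination -hs
    · rw [tangentPlane, LinearMap.mem_graph_iff, (hG _).fderiv] at hV
      simp only [ContinuousLinearMap.coe_coe, innerSL_apply_apply, Complex.inner, Complex.mul_re,
        Complex.conj_re, Complex.conj_im, hFre, hFim] at hV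
      simp only [metric, omega, LinearMap.coe_mk, AddHom.coe_mk, Complex.smul_re, Complex.smul_im,
        smul_eq_mul, hV]
      ring
    · have : metric p (s⁻¹ • F, s⁻¹ * (F.re * p.1.im - F.im * p.1.re - 1)) (T p) = -s⁻¹ := by
        simp [metric, omega, T]
        ring
      rw [this]
      exact neg_lt_zero.2 (inv_pos.2 hsp)
  · intro z hz
    have hre : (G z + Complex.I * z).re = -2 * z.im := by rw [hR z hz]; simp; ring
    have him : (G z + Complex.I * z).im = 2 * z.re := by rw [hR z hz]; simp; ring
    simp only [downwardUnit, rotationNormal, hre, him]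
    congr 1
    · ring_nf
    · refine Prod.ext (Complex.ext ?_ ?_) ?_
      · simp [X, Y, T, hR z hz]; ring
      · simp [X, Y, T, hR z hz]; ring
      · simp [X, Y, T]; ring

/-- The tangent plane contains `X` and `Y` exactly when the gradient of `u` is `(y, -x)`, that is,
when `F = 0`. -/
theorem singularSet_eq (hG : ∀ z, HasFDerivAt u (innerSL ℝ (G z)) z) :
    singularSet u = {p | p ∈ tGraph u ∧ G p.1 = -(Complex.I * p.1)} := by
  ext p
  refine and_congr_right fun _ => ⟨fun h => ?_, fun h => ?_⟩
  · have h1 : X p ∈ tangentPlane u p.1 := h ▸ X_mem_horizontalPlane p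
    have h2 : Y p ∈ tangentPlane u p.1 := h ▸ Y_mem_horizontalPlane p
    rw [tangentPlane, LinearMap.mem_graph_iff, (hG _).fderiv] at h1 h2
    simp [Complex.inner, X, Y] at h1 h2
    apply Complex.ext
    · simp [h1]
    · simp [h2]
  · ext V
    rw [tangentPlane, LinearMap.mem_graph_iff, (hG _).fderiv, horizontalPlane, LinearMap.mem_ker,
      h]
    simp only [ContinuousLinearMap.coe_coe, innerSL_apply_apply, Complex.inner, omega,
      LinearMap.coe_mk, AddHom.coe_mk]
    simp
    constructor <;> intro h <;> linarith

theorem isC11On {K : ℝ≥0} (hG : ∀ z, HasFDerivAt u (innerSL ℝ (G z)) z)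
    (hGL : LipschitzWith K G) (S : Set ℂ) : IsC11On u S := by
  refine ⟨(contDiff_of_gradient hG hGL.continuous).contDiffOn, K, ?_⟩
  have : fderiv ℝ u = fun z => innerSL ℝ (G z) := funext fun z => (hG z).fderiv
  rw [this]
  refine LipschitzWith.lipschitzOnWith (LipschitzWith.of_dist_le_mul fun z w => ?_)
  rw [dist_eq_norm, ← map_sub, innerSL_apply_norm, ← dist_eq_norm]
  exact hGL.dist_le_mul z w

/-- `hhom` is invariance of the subgraph under the dilations centered at the origin, and `htr` is
its invariance under left translation by `[x, 0]`, which moves the center. -/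
theorem isCone_subgraph (x : ℝ) (hhom : ∀ r : ℝ, 0 < r → ∀ z : ℂ, u (r • z) = r ^ 2 * u z)
    (htr : ∀ z : ℂ, u (x + z) = u z - x * z.im) : IsCone (subgraph u) ((x : ℂ), 0) := by
  rintro s _ ⟨q, hq, rfl⟩
  change q.2 ≤ u q.1 at hq
  have h1 := htr (q.1 - x)
  rw [add_sub_cancel] at h1
  have h2 := hhom (Real.exp s) (Real.exp_pos s) (q.1 - x)
  have h3 := htr (Real.exp s • (q.1 - x))
  have h4 : Real.exp (2 * s) = Real.exp s ^ 2 := by rw [← Real.exp_nat_mul]; norm_num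
  rw [h1] at hq
  change (dilationAt ((x : ℂ), 0) s q).2 ≤ u (dilationAt ((x : ℂ), 0) s q).1
  have h5 : (dilationAt ((x : ℂ), 0) s q).1 = x + Real.exp s • (q.1 - x) := by
    simp [dilationAt, mul, dilation, inv]; ring
  rw [h5, h3, h2]
  simp [dilationAt, mul, dilation, inv, h4] at hq ⊢
  nlinarith [sq_nonneg (Real.exp s)]

end Regularity

/-- A function with local Lipschitz constant at most `K` at each point is `K`-Lipschitz. -/
theorem lipschitzWith_of_eventually {E F : Type*} [NormedAddCommGroup E] [NormedSpace ℝ E]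
    [NormedAddCommGroup F] {f : E → F} {K : ℝ≥0}
    (h : ∀ x, ∀ᶠ y in 𝓝 x, ‖f y - f x‖ ≤ K * ‖y - x‖) : LipschitzWith K f := by
  have hc : Continuous f := by
    refine continuous_iff_continuousAt.2 fun x => tendsto_iff_norm_sub_tendsto_zero.2 ?_
    have h1 : Tendsto (fun y => K * ‖y - x‖) (𝓝 x) (𝓝 0) := by
      have : Continuous fun y => K * ‖y - x‖ := by fun_prop
      simpa using this.tendsto x
    exact squeeze_zero' (.of_forall fun _ => norm_nonneg _) (h x) h1
  refine LipschitzWith.of_dist_le_mul fun b a => ?_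
  rw [dist_eq_norm, dist_eq_norm]
  -- A mean value inequality along the segment from `a` to `b`: the estimate centered at each of its
  -- points bounds the right slopes of the distance to `f a`.
  have key := image_le_of_liminf_slope_right_le_deriv_boundary
    (f := fun t : ℝ => ‖f (a + t • (b - a)) - f a‖) (a := 0) (b := 1)
    (B := fun t => K * ‖b - a‖ * t) (B' := fun _ => K * ‖b - a‖) (by fun_prop) (by simp)
    (by fun_prop) (fun x _ => by
      simpa using ((hasDerivAt_id x).const_mul (K * ‖b - a‖)).hasDerivWithinAt) ?_
    (Set.right_mem_Icc.2 zero_le_one)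
  · simpa using key
  · intro x _ r hr
    refine Eventually.frequently ?_
    have hcont : Tendsto (fun t : ℝ => a + t • (b - a)) (𝓝[>] x) (𝓝 (a + x • (b - a))) :=
      (by fun_prop : Continuous fun t : ℝ => a + t • (b - a)).continuousAt.tendsto.mono_left
        nhdsWithin_le_nhds
    filter_upwards [hcont.eventually (h _), self_mem_nhdsWithin] with t ht hxt
    have hxt' : 0 < t - x := sub_pos.2 hxt
    refine lt_of_le_of_lt ?_ hr
    rw [slope_def_field, div_le_iff₀ hxt']
    have h1 : a + t • (b - a) - (a + x • (b - a)) = (t - x) • (b - a) := by module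
    rw [h1, norm_smul, Real.norm_of_nonneg hxt'.le] at ht
    calc _ ≤ ‖(f (a + t • (b - a)) - f a) - (f (a + x • (b - a)) - f a)‖ := norm_sub_norm_le _ _
      _ = ‖f (a + t • (b - a)) - f (a + x • (b - a))‖ := by rw [sub_sub_sub_cancel_right]
      _ ≤ _ := ht
      _ = _ := by ring

/-! The function `-ξη + β η|η|` -/

/-- `-ξη + β η|η|` at `ξ + iη`. -/
noncomputable def piece (β : ℝ) (w : ℂ) : ℝ := -(w.re * w.im) + β * (w.im * |w.im|)

/-- The gradient of `piece β`. -/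
noncomputable def pieceGrad (β : ℝ) (w : ℂ) : ℂ := ⟨-w.im, -w.re + 2 * β * |w.im|⟩

theorem hasDerivAt_mul_abs (y : ℝ) : HasDerivAt (fun y : ℝ => y * |y|) (2 * |y|) y := by
  rcases lt_trichotomy y 0 with h | rfl | h
  · have h1 : (fun y : ℝ => y * |y|) =ᶠ[𝓝 y] fun y => -y ^ 2 := by
      filter_upwards [eventually_lt_nhds h] with t ht
      rw [abs_of_neg ht]; ring
    rw [h1.hasDerivAt_iff, abs_of_neg h]
    exact (hasDerivAt_pow 2 y).neg.congr_deriv (by simp)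
  · rw [hasDerivAt_iff_tendsto_slope]
    have h1 : Tendsto (fun y : ℝ => |y|) (𝓝[≠] 0) (𝓝 (2 * |0|)) := by
      have := (continuous_abs (G := ℝ)).tendsto 0
      simp only [abs_zero, mul_zero] at this ⊢
      exact this.mono_left nhdsWithin_le_nhds
    refine h1.congr' ?_
    filter_upwards [self_mem_nhdsWithin] with t ht
    have : t ≠ 0 := ht
    rw [slope_def_field]
    field_simp
    simp
  · have h1 : (fun y : ℝ => y * |y|) =ᶠ[𝓝 y] fun y => y ^ 2 := by
      filter_upwards [eventually_gt_nhds h] with t ht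
      rw [abs_of_pos ht]; ring
    rw [h1.hasDerivAt_iff, abs_of_pos h]
    exact (hasDerivAt_pow 2 y).congr_deriv (by simp)

theorem hasFDerivAt_piece (β : ℝ) (w : ℂ) :
    HasFDerivAt (piece β) (innerSL ℝ (pieceGrad β w)) w := by
  have h1 := (((Complex.reCLM.hasFDerivAt (x := w)).mul (Complex.imCLM.hasFDerivAt)).neg.add
    (((hasDerivAt_mul_abs w.im).comp_hasFDerivAt w
      (Complex.imCLM.hasFDerivAt)).const_mul β))
  refine h1.congr_fderiv ?_
  ext h
  simp [Complex.inner, pieceGrad]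
  ring

theorem lipschitzWith_pieceGrad (β : ℝ) : LipschitzWith (2 + 2 * ‖β‖₊) (pieceGrad β) := by
  refine LipschitzWith.of_dist_le_mul fun z w => ?_
  rw [dist_eq_norm, dist_eq_norm]
  refine (Complex.norm_le_abs_re_add_abs_im _).trans ?_
  have h1 := Complex.abs_re_le_norm (z - w)
  have h2 := Complex.abs_im_le_norm (z - w)
  have h3 := abs_abs_sub_abs_le z.im w.im
  simp only [Complex.sub_re, Complex.sub_im, pieceGrad] at *
  have e1 : -z.im - -w.im = -(z.im - w.im) := by ring
  have e2 : -z.re + 2 * β * |z.im| - (-w.re + 2 * β * |w.im|) =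
    -(z.re - w.re) + 2 * β * (|z.im| - |w.im|) := by ring
  have h4 := abs_add_le (-(z.re - w.re)) (2 * β * (|z.im| - |w.im|))
  rw [abs_neg, abs_mul, abs_mul, abs_two] at h4
  have h5 : |β| * |(|z.im| - |w.im|)| ≤ |β| * ‖z - w‖ :=
    mul_le_mul_of_nonneg_left (h3.trans h2) (abs_nonneg _)
  rw [e1, e2, abs_neg]
  push_cast
  rw [Real.norm_eq_abs]
  linarith

theorem piece_smul (β : ℝ) {r : ℝ} (hr : 0 < r) (w : ℂ) :
    piece β (r • w) = r ^ 2 * piece β w := by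
  simp only [piece, Complex.smul_re, Complex.smul_im, smul_eq_mul, abs_mul, abs_of_pos hr]
  ring

/-! ### The model piece turned to an arbitrary axis: its normal and its ruling. -/

section Rotated

variable {e : ℂ}

theorem mul_conj_self (he : ‖e‖ = 1) : e * (starRingEnd ℂ) e = 1 := by
  rw [Complex.mul_conj, Complex.normSq_eq_norm_sq, he]; simp

theorem eq_mul_conj_mul (he : ‖e‖ = 1) (z : ℂ) : z = e * (z * (starRingEnd ℂ) e) := by
  linear_combination -z * mul_conj_self he

theorem hasFDerivAt_piece_rotated (e : ℂ) (β : ℝ) (z : ℂ) :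
    HasFDerivAt (fun z => piece β (z * (starRingEnd ℂ) e))
      (innerSL ℝ (e * pieceGrad β (z * (starRingEnd ℂ) e))) z := by
  have h1 : HasFDerivAt (fun z : ℂ => z * (starRingEnd ℂ) e)
      ((ContinuousLinearMap.mul ℝ ℂ).flip ((starRingEnd ℂ) e)) z :=
    ((ContinuousLinearMap.mul ℝ ℂ).flip ((starRingEnd ℂ) e)).hasFDerivAt
  refine ((hasFDerivAt_piece β (z * (starRingEnd ℂ) e)).comp z h1).congr_fderiv ?_
  ext h
  simp [Complex.inner]
  ring

theorem lipschitzWith_pieceGrad_rotated (he : ‖e‖ = 1) (β : ℝ) :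
    LipschitzWith (2 + 2 * ‖β‖₊) fun z => e * pieceGrad β (z * (starRingEnd ℂ) e) := by
  refine LipschitzWith.of_dist_le_mul fun z w => ?_
  have := (lipschitzWith_pieceGrad β).dist_le_mul (z * (starRingEnd ℂ) e) (w * (starRingEnd ℂ) e)
  rw [dist_eq_norm, dist_eq_norm, ← sub_mul, norm_mul, RCLike.norm_conj, he, mul_one] at this
  rwa [dist_eq_norm, dist_eq_norm, ← mul_sub, norm_mul, he, one_mul]

theorem rot_re (θ : ℝ) : (rot θ).re = Real.cos θ := by
  simp [rot, Complex.exp_ofReal_mul_I_re]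

theorem rot_im (θ : ℝ) : (rot θ).im = Real.sin θ := by
  simp [rot, Complex.exp_ofReal_mul_I_im]

theorem norm_rot (θ : ℝ) : ‖rot θ‖ = 1 := Complex.norm_exp_ofReal_mul_I θ

theorem rot_add (θ φ : ℝ) : rot (θ + φ) = rot θ * rot φ := by
  simp [rot, add_mul, Complex.exp_add]

theorem rot_zero : rot 0 = 1 := by simp [rot]

theorem rot_two_pi : rot (2 * Real.pi) = 1 := by simp [rot]

theorem ae_im_mul_conj_ne_zero (he : ‖e‖ = 1) :
    ∀ᵐ z : ℂ, (z * (starRingEnd ℂ) e).im ≠ 0 := by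
  let S : Submodule ℝ ℂ := LinearMap.ker (Complex.imLm ∘ₗ
    (LinearMap.mulRight ℝ ((starRingEnd ℂ) e)))
  have hS : S ≠ ⊤ := by
    intro h
    have h1 : e * Complex.I ∈ S := h ▸ Submodule.mem_top
    have h2 : e * Complex.I * (starRingEnd ℂ) e = Complex.I := by
      linear_combination Complex.I * mul_conj_self he
    simp only [S, LinearMap.mem_ker, LinearMap.comp_apply, LinearMap.mulRight_apply, h2] at h1
    simp at h1
  have := Measure.addHaar_submodule (volume : Measure ℂ) S hS
  refine measure_mono_null (fun z hz => ?_) this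
  simpa [S] using hz

/-- The horizontal normal of the graph of `piece (cot a)` rotated to the axis `e`. -/
theorem pieceGrad_calibrated (he : ‖e‖ = 1) {a : ℝ} (ha0 : 0 < a) (hapi : a < Real.pi) {z : ℂ}
    {θ : ℝ} (h : (0 ≤ (z * (starRingEnd ℂ) e).im ∧ θ = a) ∨
      ((z * (starRingEnd ℂ) e).im ≤ 0 ∧ θ = -a)) :
    e * pieceGrad (Real.cot a) (z * (starRingEnd ℂ) e) + Complex.I * z =
      ‖e * pieceGrad (Real.cot a) (z * (starRingEnd ℂ) e) + Complex.I * z‖ •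
        (Complex.I * (rot θ * e)) := by
  have hs := Real.sin_pos_of_pos_of_lt_pi ha0 hapi
  set w := z * (starRingEnd ℂ) e with hw
  have h1 : e * pieceGrad (Real.cot a) w + Complex.I * z =
      (2 * |w.im| / Real.sin a) • (Complex.I * (rot θ * e)) := by
    -- In axis coordinates `F` is `(-2η, 2 cot a |η|)`, orthogonal to the ruling direction `rot (±
    -- a)`, with the sign of `η`.
    have h2 : pieceGrad (Real.cot a) w + Complex.I * w =
        (2 * |w.im| / Real.sin a) • (Complex.I * rot θ) := by
      rw [Real.cot_eq_cos_div_sin]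
      rcases h with ⟨h, rfl⟩ | ⟨h, rfl⟩
      · rw [abs_of_nonneg h]
        apply Complex.ext
        · simp [pieceGrad, -Complex.real_smul, Complex.smul_re, rot_im]
          field_simp
          ring
        · simp [pieceGrad, -Complex.real_smul, Complex.smul_im, rot_re, abs_of_nonneg h]
          field_simp
      · rw [abs_of_nonpos h]
        apply Complex.ext
        · simp [pieceGrad, -Complex.real_smul, Complex.smul_re, rot_im]
          field_simp
          ring
        · simp [pieceGrad, -Complex.real_smul, Complex.smul_im, rot_re, abs_of_nonpos h]
          field_simp
    have h3 := eq_mul_conj_mul he z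
    rw [← hw] at h3
    calc _ = e * (pieceGrad (Real.cot a) w + Complex.I * w) := by
          linear_combination Complex.I * h3
      _ = _ := by rw [h2, mul_smul_comm]; congr 1; ring
  rw [h1, norm_smul, norm_mul, norm_mul, Complex.norm_I, norm_rot, he,
    Real.norm_of_nonneg (by positivity)]
  simp

/-- The two halflines issuing from the point at `s` on the axis `e`. -/
theorem mem_horizontalHalfline_union_iff (he : ‖e‖ = 1) {a : ℝ} (ha0 : 0 < a)
    (hapi : a < Real.pi) (s : ℝ) (p : Heis) :
    p ∈ horizontalHalfline (s • e, 0) (rot a * e) ∪ horizontalHalfline (s • e, 0) (rot (-a) * e) ↔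
      s = (p.1 * (starRingEnd ℂ) e).re - Real.cot a * |(p.1 * (starRingEnd ℂ) e).im| ∧
        p.2 = piece (Real.cot a) (p.1 * (starRingEnd ℂ) e) := by
  have hs := Real.sin_pos_of_pos_of_lt_pi ha0 hapi
  have he2 : e.re ^ 2 + e.im ^ 2 = 1 := by
    have := Complex.sq_norm e
    rw [he, Complex.normSq_apply] at this
    linarith
  -- A horizontal halfline from `(s, 0)` is straight, reaching `s + w rot θ` at height `-s w sin θ`,
  -- that is, `-sη`. Eliminating `s = ξ - cot a |η|` gives `piece`.
  have hmem : ∀ θ, p ∈ horizontalHalfline (s • e, 0) (rot θ * e) ↔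
      ∃ w : ℝ, 0 ≤ w ∧ p.1 * (starRingEnd ℂ) e = s + w • rot θ ∧ p.2 = -(s * w * Real.sin θ) := by
    intro θ
    refine exists_congr fun w => and_congr_right fun _ => ?_
    rw [Prod.ext_iff]
    refine and_congr ?_ ?_
    · have : ((((s • e, 0) : Heis) + w • ((rot θ * e).re • X (s • e, 0) +
          (rot θ * e).im • Y (s • e, 0))).1 : ℂ) = e * (s + w • rot θ) := by
        apply Complex.ext
        · simp [X, Y]; ring
        · simp [X, Y]; ring
      rw [this]
      constructor
      · intro h
        rw [h]
        linear_combination (s + w • rot θ) * mul_conj_self he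
      · intro h
        rw [← h]
        exact eq_mul_conj_mul he _
    · have : ((((s • e, 0) : Heis) + w • ((rot θ * e).re • X (s • e, 0) +
          (rot θ * e).im • Y (s • e, 0))).2 : ℝ) = -(s * w * Real.sin θ) := by
        simp [X, Y, rot_re, rot_im]
        linear_combination (-(s * w * Real.sin θ)) * he2
      rw [this]
  rw [Set.mem_union, hmem, hmem]
  set ζ := p.1 * (starRingEnd ℂ) e
  rw [Real.cot_eq_cos_div_sin]
  constructor
  · rintro (⟨w, hw, h1, h2⟩ | ⟨w, hw, h1, h2⟩)
    · have hre : ζ.re = s + w * Real.cos a := by rw [h1]; simp [rot_re]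
      have him : ζ.im = w * Real.sin a := by rw [h1]; simp [rot_im]
      have habs : |ζ.im| = w * Real.sin a := by rw [him, abs_of_nonneg (by positivity)]
      rw [piece, h2, habs, hre, him]
      constructor <;> field_simp <;> ring
    · have hre : ζ.re = s + w * Real.cos a := by rw [h1]; simp [rot_re]
      have him : ζ.im = -(w * Real.sin a) := by rw [h1]; simp [rot_im]
      have habs : |ζ.im| = w * Real.sin a := by
        rw [him, abs_neg, abs_of_nonneg (by positivity)]
      rw [piece, h2, habs, hre, him, Real.sin_neg]
      constructor <;> field_simp <;> ring
  · rintro ⟨h1, h2⟩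
    rcases le_total 0 ζ.im with h | h
    · left
      rw [abs_of_nonneg h] at h1
      refine ⟨ζ.im / Real.sin a, by positivity, ?_, ?_⟩
      · apply Complex.ext
        · simp [rot_re, -Complex.real_smul, Complex.smul_re]; rw [h1]; field_simp; ring
        · simp [rot_im, -Complex.real_smul, Complex.smul_im]; field_simp
      · rw [h2, piece, abs_of_nonneg h, h1]; field_simp; ring
    · right
      rw [abs_of_nonpos h] at h1
      refine ⟨-ζ.im / Real.sin a, div_nonneg (neg_nonneg.2 h) hs.le, ?_, ?_⟩
      · apply Complex.ext
        · simp [rot_re, -Complex.real_smul, Complex.smul_re]; rw [h1]; field_simp; ring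
        · simp [rot_im, -Complex.real_smul, Complex.smul_im]; field_simp
      · rw [h2, piece, abs_of_nonpos h, h1, Real.sin_neg]; field_simp; ring

end Rotated

/-! The surface with a singular line -/

theorem exists_graph_lineSurface (a : ℝ) (ha0 : 0 < a) (hapi : a < Real.pi) :
    ∃ u : ℂ → ℝ,
        tGraph u = lineSurface (fun _ => a) ∧
        (∀ z : ℂ, u z = -(z.re * z.im) + Real.cot a * (z.im * |z.im|)) ∧
        IsAreaMinimizing (subgraph u) ∧
        (∀ x : ℝ, IsCone (subgraph u) ((x : ℂ), 0)) ∧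
        IsC11On u Set.univ ∧
        (∃ N : Heis → Heis, IsUnitNormalField u N ∧
          ContinuousOn N (tGraph u) ∧
          LocallyLipschitzOn (tGraph u) N ∧
          ∀ z : ℂ, z.re = Real.cot a * |z.im| →
            N (z, u z) = rotationNormal (z, u z)) ∧
        singularSet u = {p | ∃ x : ℝ, p = ((x : ℂ), 0)} := by
  have hG := hasFDerivAt_piece (Real.cot a)
  have hL := lipschitzWith_pieceGrad (Real.cot a)
  have hs := Real.sin_pos_of_pos_of_lt_pi ha0 hapi
  refine ⟨piece (Real.cot a), ?_, fun z => rfl, ?_, fun x => ?_, isC11On hG hL _, ?_, ?_⟩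
  · ext p
    have h := fun s => mem_horizontalHalfline_union_iff (e := 1) (by simp) ha0 hapi s p
    simp only [map_one, mul_one, Complex.real_smul] at h
    simp only [lineSurface, Set.mem_iUnion, h]
    simp [tGraph]
  · let ρ : Bool → ℂ := fun b => if b then rot a else rot (-a)
    refine isAreaMinimizing_subgraph (ρ := ρ) (fun b => ?_) hG hL.continuous ?_
    · cases b <;> simp [ρ, norm_rot]
    · have h1 := ae_im_mul_conj_ne_zero (e := 1) (by simp)
      simp only [map_one, mul_one] at h1
      have hc := fun z θ => pieceGrad_calibrated (e := 1) (by simp) ha0 hapi (z := z) (θ := θ)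
      simp only [map_one, mul_one, one_mul] at hc
      filter_upwards [h1] with z hz
      rcases lt_or_gt_of_ne hz with h | h
      · refine ⟨false, fun b => ?_, hc z (-a) (Or.inr ⟨h.le, rfl⟩)⟩
        cases b
        · exact Or.inl rfl
        · right
          simp [ρ, rot_re, rot_im]
          nlinarith [mul_neg_of_pos_of_neg hs h]
      · refine ⟨true, fun b => ?_, hc z a (Or.inl ⟨h.le, rfl⟩)⟩
        cases b
        · right
          simp [ρ, rot_re, rot_im]
          nlinarith [mul_pos hs h]
        · exact Or.inl rfl
  · refine isCone_subgraph x (fun r hr z => piece_smul _ hr z) fun z => ?_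
    simp [piece]
    ring
  · refine exists_unitNormalField hG hL (R := {z | z.re = Real.cot a * |z.im|}) fun z hz => ?_
    have hz' : z.re = Real.cot a * |z.im| := hz
    apply Complex.ext
    · simp [pieceGrad]
    · simp [pieceGrad]
      linarith
  · rw [singularSet_eq hG]
    ext p
    constructor
    · rintro ⟨h1, h2⟩
      have h3 : p.1.im = 0 := by
        have := congrArg Complex.re h2
        simp [pieceGrad] at this
        linarith
      refine ⟨p.1.re, Prod.ext (Complex.ext (by simp) (by simp [h3])) ?_⟩
      rw [show p.2 = piece _ p.1 from h1]
      simp [piece, h3]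
    · rintro ⟨x, rfl⟩
      refine ⟨by simp [tGraph, piece], ?_⟩
      apply Complex.ext <;> simp [pieceGrad]

/-! The surfaces with several singular halflines -/

section Wedge

variable {e : ℂ} {a : ℝ}

theorem mul_conj_of_eq_smul_rot (he : ‖e‖ = 1) (r θ : ℝ) :
    (r • (rot θ * e)) * (starRingEnd ℂ) e = r • rot θ := by
  rw [smul_mul_assoc, mul_assoc, mul_conj_self he, mul_one]

theorem smul_rot_re (r θ : ℝ) : (r • rot θ).re = r * Real.cos θ := by
  rw [Complex.smul_re, rot_re, smul_eq_mul]

theorem smul_rot_im (r θ : ℝ) : (r • rot θ).im = r * Real.sin θ := by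
  rw [Complex.smul_im, rot_im, smul_eq_mul]

theorem norm_smul_rot (w : ℂ) : w = ‖w‖ • rot (Complex.arg w) := by
  simp [rot]

/-- The starting parameter of the halfline through a point, in polar form: its sign is that of `a -
|θ|` for `r > 0`, so it detects the wedge. -/
theorem sub_cot_mul_eq {r θ : ℝ} (ha0 : 0 < a) (hapi : a < Real.pi) (hr : 0 ≤ r)
    (hθ : |θ| ≤ Real.pi) : (r • rot θ).re - Real.cot a * |(r • rot θ).im| =
      r * Real.sin (a - |θ|) / Real.sin a := by
  have hs := Real.sin_pos_of_pos_of_lt_pi ha0 hapi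
  have h1 : |Real.sin θ| = Real.sin |θ| := by
    rcases abs_choice θ with h | h
    · rw [h, abs_of_nonneg]
      exact Real.sin_nonneg_of_nonneg_of_le_pi (h ▸ abs_nonneg θ) (h ▸ hθ)
    · rw [h, Real.sin_neg, abs_of_nonpos]
      have := Real.sin_nonneg_of_nonneg_of_le_pi (h ▸ abs_nonneg θ) (h ▸ hθ)
      rw [Real.sin_neg] at this
      linarith
  rw [smul_rot_re, smul_rot_im, abs_mul, abs_of_nonneg hr, h1, Real.sin_sub, Real.cos_abs,
    Real.cot_eq_cos_div_sin]
  field_simp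

theorem mem_wedge_iff (he : ‖e‖ = 1) (ha0 : 0 < a) (hapi : a < Real.pi) (z : ℂ) :
    z ∈ wedge e a ↔ 0 ≤ (z * (starRingEnd ℂ) e).re -
      Real.cot a * |(z * (starRingEnd ℂ) e).im| := by
  have hs := Real.sin_pos_of_pos_of_lt_pi ha0 hapi
  constructor
  · rintro ⟨r, θ, hr, h1, h2, rfl⟩
    have h3 : |θ| ≤ a := abs_le.2 ⟨h1, h2⟩
    rw [mul_conj_of_eq_smul_rot he, sub_cot_mul_eq ha0 hapi hr (h3.trans hapi.le)]
    have := Real.sin_nonneg_of_nonneg_of_le_pi (sub_nonneg.2 h3)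
      (by linarith [abs_nonneg θ])
    positivity
  · intro h
    set w := z * (starRingEnd ℂ) e with hw
    have hz := eq_mul_conj_mul he z
    rw [← hw] at hz
    by_cases h0 : w = 0
    · refine ⟨0, 0, le_rfl, by linarith, ha0.le, by rw [hz, h0]; simp⟩
    have hpos : 0 < ‖w‖ := norm_pos_iff.2 h0
    have hpi := Complex.abs_arg_le_pi w
    have h1 : |Complex.arg w| ≤ a := by
      by_contra hlt
      rw [not_le] at hlt
      rw [norm_smul_rot w, sub_cot_mul_eq ha0 hapi hpos.le hpi] at h
      have h2 := Real.sin_neg_of_neg_of_neg_pi_lt (x := a - |Complex.arg w|) (by linarith)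
        (by linarith)
      exact absurd h (not_le.2 (div_neg_of_neg_of_pos (mul_neg_of_pos_of_neg hpos h2) hs))
    refine ⟨‖w‖, Complex.arg w, hpos.le, (abs_le.1 h1).1, (abs_le.1 h1).2, ?_⟩
    rw [← smul_mul_assoc, ← norm_smul_rot, hz]
    ring

theorem isClosed_wedge (he : ‖e‖ = 1) (ha0 : 0 < a) (hapi : a < Real.pi) :
    IsClosed (wedge e a) := by
  have : wedge e a = {z | 0 ≤ (z * (starRingEnd ℂ) e).re -
      Real.cot a * |(z * (starRingEnd ℂ) e).im|} := Set.ext (mem_wedge_iff he ha0 hapi)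
  rw [this]
  exact isClosed_le continuous_const (by fun_prop)

theorem smul_mem_wedge {r : ℝ} (hr : 0 ≤ r) {z : ℂ} (hz : z ∈ wedge e a) : r • z ∈ wedge e a := by
  obtain ⟨s, θ, hs, h1, h2, rfl⟩ := hz
  exact ⟨r * s, θ, mul_nonneg hr hs, h1, h2, by rw [mul_smul]⟩

theorem cos_lt_cos_of_lt_of_lt {x y : ℝ} (hx : 0 ≤ x) (hxy : x < y) (hy : y < 2 * Real.pi - x) :
    Real.cos y < Real.cos x := by
  rcases le_total y Real.pi with h | h
  · exact Real.cos_lt_cos_of_nonneg_of_le_pi hx h hxy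
  · rw [← Real.cos_two_pi_sub y]
    exact Real.cos_lt_cos_of_nonneg_of_le_pi hx (by linarith) (by linarith)

/-- A point strictly on the positive side of the axis is closer in angle to the border `a` than to
any other direction outside the open wedge. At `θ = 0` the two borders tie, hence `0 < θ`. -/
theorem eq_or_cos_sub_lt {θ τ : ℝ} (h0 : 0 < θ) (h1 : θ ≤ a)
    (h2 : a ≤ τ) (h3 : τ ≤ 2 * Real.pi - a) : τ = a ∨ Real.cos (τ - θ) < Real.cos (a - θ) := by
  rcases h2.eq_or_lt with h | h
  · exact Or.inl h.symm
  · exact Or.inr (cos_lt_cos_of_lt_of_lt (by linarith) (by linarith) (by linarith))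

theorem rot_mul_inner (he : ‖e‖ = 1) (τ r θ : ℝ) :
    (rot τ * e).re * (r • (rot θ * e)).re + (rot τ * e).im * (r • (rot θ * e)).im =
      r * Real.cos (τ - θ) := by
  have he2 : e.re ^ 2 + e.im ^ 2 = 1 := by
    have := Complex.sq_norm e
    rw [he, Complex.normSq_apply] at this
    linarith
  simp only [Complex.smul_re, Complex.smul_im, Complex.mul_re, Complex.mul_im, rot_re, rot_im,
    smul_eq_mul, Real.cos_sub]
  linear_combination (r * (Real.cos τ * Real.cos θ + Real.sin τ * Real.sin θ)) * he2

theorem piece_eq_zero {β : ℝ} {w : ℂ} (h : w.re = β * |w.im|) : piece β w = 0 := by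
  rw [piece, h]; ring

theorem pieceGrad_eq {β : ℝ} {w : ℂ} (h : w.re = β * |w.im|) : pieceGrad β w = Complex.I * w := by
  apply Complex.ext
  · simp [pieceGrad]
  · simp [pieceGrad]
    linarith

end Wedge

/-! ### Angular position of the wedges: they cover the plane and overlap only along borders. -/

namespace IsConfiguration

variable {k : ℕ} [NeZero k] {v : Fin k → ℂ} {α : Fin k → ℝ}

/-- Going around, one crosses half of the wedge at `0`, the full openings `2 α l` of those in
between, and half of the wedge at `i`. -/
theorem eq_rot_mul_zero {n : ℕ} {v : Fin (n + 1) → ℂ} {α : Fin (n + 1) → ℝ}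
    (h : IsConfiguration v α) (i : Fin (n + 1)) :
    v i = rot (2 * ∑ l ∈ Finset.Iio i, α l + α i - α 0) * v 0 := by
  induction i using Fin.induction with
  | zero =>
    have : Finset.Iio (0 : Fin (n + 1)) = ∅ := by ext l; simp
    simp [this, rot_zero]
  | succ i ih =>
    have h1 := h.rotate i.castSucc
    rw [Fin.coeSucc_eq_succ, ih, ← mul_assoc, ← rot_add] at h1
    have h2 : Finset.Iio i.succ = insert i.castSucc (Finset.Iio i.castSucc) := by
      ext l
      simp only [Finset.mem_Iio, Finset.mem_insert, Fin.lt_def, Fin.ext_iff, Fin.val_succ,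
        Fin.val_castSucc]
      omega
    rw [h1, h2, Finset.sum_insert (by simp)]
    congr 2
    ring

theorem exists_angle_of_lt (h : IsConfiguration v α) {i j : Fin k} (hij : i < j) :
    ∃ σ : ℝ, α i + α j ≤ σ ∧ σ ≤ 2 * Real.pi - α i - α j ∧ v j = rot σ * v i := by
  obtain ⟨n, rfl⟩ : ∃ n, k = n + 1 := ⟨k - 1, by have := NeZero.ne k; omega⟩
  have hi := h.eq_rot_mul_zero i
  have hj := h.eq_rot_mul_zero j
  have h1 : ∑ l ∈ Finset.Iio i, α l + α i ≤ ∑ l ∈ Finset.Iio j, α l := by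
    rw [add_comm, ← Finset.sum_insert (by simp)]
    refine Finset.sum_le_sum_of_subset_of_nonneg (fun l hl => ?_) fun l _ _ => (h.pos l).le
    rw [Finset.mem_insert, Finset.mem_Iio] at hl
    rw [Finset.mem_Iio]
    rcases hl with rfl | hl
    · exact hij
    · exact hl.trans hij
  have h2 : ∑ l ∈ Finset.Iio j, α l + α j ≤ Real.pi := by
    rw [add_comm, ← Finset.sum_insert (by simp), ← h.sum_eq]
    exact Finset.sum_le_sum_of_subset_of_nonneg (Finset.subset_univ _) fun l _ _ => (h.pos l).le
  have h3 : 0 ≤ ∑ l ∈ Finset.Iio i, α l := Finset.sum_nonneg fun l _ => (h.pos l).le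
  -- The lower bound holds because the two half-wedges lie between the axes, the upper one because
  -- all openings add up to `2π`.
  refine ⟨2 * ∑ l ∈ Finset.Iio j, α l + α j - (2 * ∑ l ∈ Finset.Iio i, α l + α i),
    by linarith, by linarith, ?_⟩
  rw [hj, hi, ← mul_assoc, ← rot_add]
  congr 2
  ring

/-- The angle from `v i` to `v j`. -/
theorem exists_angle (h : IsConfiguration v α) {i j : Fin k} (hij : i ≠ j) :
    ∃ σ : ℝ, α i + α j ≤ σ ∧ σ ≤ 2 * Real.pi - α i - α j ∧ v j = rot σ * v i := by
  rcases lt_or_gt_of_ne hij with hlt | hlt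
  · exact h.exists_angle_of_lt hlt
  · obtain ⟨σ, h1, h2, h3⟩ := h.exists_angle_of_lt hlt
    refine ⟨2 * Real.pi - σ, by linarith, by linarith, ?_⟩
    rw [h3, ← mul_assoc, ← rot_add, sub_add_cancel, rot_two_pi, one_mul]

/-- The angle from `v i` to the border `rot (α j) * v j`. -/
theorem exists_angle_border (h : IsConfiguration v α) (i j : Fin k) :
    ∃ τ : ℝ, α i ≤ τ ∧ τ ≤ 2 * Real.pi - α i ∧ rot (α j) * v j = rot τ * v i := by
  rcases eq_or_ne i j with rfl | hij
  · exact ⟨α i, le_rfl, by linarith [h.lt_pi i], rfl⟩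
  · obtain ⟨σ, h1, h2, h3⟩ := h.exists_angle hij
    have := h.pos j
    exact ⟨α j + σ, by linarith, by linarith, by rw [h3, ← mul_assoc, ← rot_add]⟩

theorem rot_neg_mul (h : IsConfiguration v α) (i : Fin k) :
    rot (-α i) * v i = rot (α (i - 1)) * v (i - 1) := by
  have h1 := h.rotate (i - 1)
  rw [sub_add_cancel] at h1
  rw [h1, ← mul_assoc, ← rot_add]
  congr 2
  ring

/-- Two wedges meet along their borders only. -/
theorem re_eq_of_mem_wedge (h : IsConfiguration v α) {i j : Fin k} (hij : i ≠ j) {z : ℂ}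
    (hi : z ∈ wedge (v i) (α i)) (hj : z ∈ wedge (v j) (α j)) :
    (z * (starRingEnd ℂ) (v i)).re = Real.cot (α i) * |(z * (starRingEnd ℂ) (v i)).im| := by
  obtain ⟨r, θ, hr, h1, h2, hz⟩ := hi
  obtain ⟨r', θ', hr', h1', h2', hz'⟩ := hj
  have hn : ‖z‖ = r := by
    rw [hz, norm_smul, norm_mul, norm_rot, h.unit, Real.norm_of_nonneg hr]; ring
  have hn' : ‖z‖ = r' := by
    rw [hz', norm_smul, norm_mul, norm_rot, h.unit, Real.norm_of_nonneg hr']; ring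
  obtain rfl : r = r' := hn.symm.trans hn'
  rw [hz, mul_conj_of_eq_smul_rot (h.unit i)]
  rcases hr.eq_or_lt with rfl | hr0
  · simp
  rw [← sub_eq_zero, sub_cot_mul_eq (h.pos i) (h.lt_pi i) hr
    ((abs_le.2 ⟨h1, h2⟩).trans (h.lt_pi i).le)]
  obtain ⟨σ, hσ1, hσ2, hσ⟩ := h.exists_angle hij
  have hv : v i ≠ 0 := norm_ne_zero_iff.1 (by rw [h.unit]; norm_num)
  have h3 : rot θ = rot (θ' + σ) := by
    have h4 : r • (rot θ * v i) = r • (rot (θ' + σ) * v i) := by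
      rw [← hz, hz', hσ, ← mul_assoc, rot_add]
    exact mul_right_cancel₀ hv (smul_right_injective ℂ hr0.ne' h4)
  have h4 : Real.cos (θ' + σ - θ) = 1 := by
    have h5 := congrArg Complex.re h3
    have h6 := congrArg Complex.im h3
    rw [rot_re, rot_re] at h5
    rw [rot_im, rot_im] at h6
    rw [Real.cos_sub, h5, h6]
    nlinarith [Real.sin_sq_add_cos_sq (θ' + σ)]
  obtain ⟨m, hm⟩ := (Real.cos_eq_one_iff _).1 h4
  have hπ := Real.pi_pos
  suffices habs : |θ| = α i by rw [habs]; simp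
  have hle : |θ| ≤ α i := abs_le.2 ⟨h1, h2⟩
  refine le_antisymm hle ?_
  -- Here `θ = θ' + σ - 2πm`. The bounds on `σ` and `|θ'| ≤ α j` push `θ` up to at least `α i` when
  -- `m ≤ 0`, and down to at most `-α i` when `m ≥ 1`.
  rcases le_or_gt m 0 with hm0 | hm0
  · have : (m : ℝ) ≤ 0 := by exact_mod_cast hm0
    have : (m : ℝ) * (2 * Real.pi) ≤ 0 := mul_nonpos_of_nonpos_of_nonneg this (by positivity)
    exact le_trans (by linarith) (le_abs_self θ)
  · have : (1 : ℝ) ≤ m := by exact_mod_cast hm0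
    have : 2 * Real.pi ≤ (m : ℝ) * (2 * Real.pi) := le_mul_of_one_le_left (by positivity) this
    exact le_trans (by linarith) (neg_le_abs θ)

/-- The wedges cover the plane. -/
theorem exists_mem_wedge (h : IsConfiguration v α) (z : ℂ) : ∃ i, z ∈ wedge (v i) (α i) := by
  -- Take the border direction nearest to `z`. Then `z` lies in one of the two wedges adjacent to
  -- it, since otherwise the far border of that wedge would be nearer.
  obtain ⟨i, hi⟩ := Finite.exists_max fun i =>
    (rot (α i) * v i).re * z.re + (rot (α i) * v i).im * z.im
  have hρ : ‖rot (α i) * v i‖ = 1 := by rw [norm_mul, norm_rot, h.unit, one_mul]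
  set ρ := rot (α i) * v i with hρ'
  set w := z * (starRingEnd ℂ) ρ with hw
  set φ := Complex.arg w with hφ
  have hz : z = ‖w‖ • (rot φ * ρ) := by
    rw [← smul_mul_assoc, ← norm_smul_rot, mul_comm]
    exact eq_mul_conj_mul hρ z
  have hφ1 := Complex.neg_pi_lt_arg w
  have hφ2 := Complex.arg_le_pi w
  rw [← hφ] at hφ1 hφ2
  have hmax : ∀ j τ, rot (α j) * v j = rot τ * ρ → ‖w‖ * Real.cos (τ - φ) ≤ ‖w‖ * Real.cos φ := by
    intro j τ hj
    have h1 := hi j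
    have h2 := rot_mul_inner hρ 0 ‖w‖ φ
    rw [rot_zero, one_mul, zero_sub, Real.cos_neg] at h2
    rw [hj, hz, rot_mul_inner hρ, h2] at h1
    exact h1
  rcases (norm_nonneg w).eq_or_lt with h0 | h0
  · exact ⟨i, 0, 0, le_rfl, by linarith [h.pos i], (h.pos i).le, by rw [hz, ← h0]; simp⟩
  rcases le_total 0 φ with hs | hs
  · have hnext : v (i + 1) = rot (α (i + 1)) * ρ := by
      rw [h.rotate i, add_comm, rot_add, mul_assoc]
    have h1 := h.pos (i + 1)
    refine ⟨i + 1, ‖w‖, φ - α (i + 1), h0.le, by linarith, ?_, ?_⟩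
    · by_contra hlt
      have h2 := hmax (i + 1) (α (i + 1) + α (i + 1)) (by rw [hnext, ← mul_assoc, ← rot_add])
      rw [← Real.cos_neg, neg_sub] at h2
      have h3 : Real.cos φ < Real.cos (φ - (α (i + 1) + α (i + 1))) :=
        Real.cos_lt_cos_of_nonneg_of_le_pi (by linarith) hφ2 (by linarith)
      exact absurd h2 (not_le.2 (mul_lt_mul_of_pos_left h3 h0))
    · rw [hnext, ← mul_assoc, ← rot_add, sub_add_cancel]
      exact hz
  · have hprev : v i = rot (-α i) * ρ := by
      rw [hρ', ← mul_assoc, ← rot_add, neg_add_cancel, rot_zero, one_mul]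
    have h1 := h.pos i
    refine ⟨i, ‖w‖, φ + α i, h0.le, ?_, by linarith, ?_⟩
    · by_contra hlt
      have h2 := hmax (i - 1) (-α i + -α i) (by
        rw [← h.rot_neg_mul, hprev, ← mul_assoc, ← rot_add])
      have h3 : Real.cos (-φ) < Real.cos (-α i + -α i - φ) :=
        Real.cos_lt_cos_of_nonneg_of_le_pi (by linarith) (by linarith) (by linarith)
      rw [Real.cos_neg] at h3
      exact absurd h2 (not_le.2 (mul_lt_mul_of_pos_left h3 h0))
    · rw [hprev, ← mul_assoc, ← rot_add, add_neg_cancel_right]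
      exact hz

end IsConfiguration

/-! ### Gluing the pieces into the surface `Σ_α`. -/

namespace IsConfiguration

variable {k : ℕ} [NeZero k] {v : Fin k → ℂ} {α : Fin k → ℝ}

/-- The index of a wedge that contains `z`. -/
noncomputable def index (h : IsConfiguration v α) (z : ℂ) : Fin k := (h.exists_mem_wedge z).choose

theorem mem_wedge_index (h : IsConfiguration v α) (z : ℂ) :
    z ∈ wedge (v (h.index z)) (α (h.index z)) := (h.exists_mem_wedge z).choose_spec

/-- The function whose graph is the surface `Σ_α`. -/
noncomputable def height (h : IsConfiguration v α) (z : ℂ) : ℝ :=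
  piece (Real.cot (α (h.index z))) (z * (starRingEnd ℂ) (v (h.index z)))

/-- The gradient of `height`. -/
noncomputable def gradient (h : IsConfiguration v α) (z : ℂ) : ℂ :=
  v (h.index z) * pieceGrad (Real.cot (α (h.index z))) (z * (starRingEnd ℂ) (v (h.index z)))

/-- The chosen index is immaterial: a point in two wedges lies on a border of each, where every
piece vanishes. -/
theorem height_eq (h : IsConfiguration v α) {i : Fin k} {z : ℂ} (hz : z ∈ wedge (v i) (α i)) :
    h.height z = piece (Real.cot (α i)) (z * (starRingEnd ℂ) (v i)) := by
  by_cases hi : h.index z = i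
  · rw [height, hi]
  · rw [height, piece_eq_zero (h.re_eq_of_mem_wedge hi (h.mem_wedge_index z) hz),
      piece_eq_zero (h.re_eq_of_mem_wedge (Ne.symm hi) hz (h.mem_wedge_index z))]

theorem mul_pieceGrad_eq (h : IsConfiguration v α) (i : Fin k) {β : ℝ} {z : ℂ}
    (hz : (z * (starRingEnd ℂ) (v i)).re = β * |(z * (starRingEnd ℂ) (v i)).im|) :
    v i * pieceGrad β (z * (starRingEnd ℂ) (v i)) = Complex.I * z := by
  rw [pieceGrad_eq hz]
  linear_combination (Complex.I * z) * mul_conj_self (h.unit i)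

/-- On a common border both candidates for the gradient equal `i z`. -/
theorem gradient_eq (h : IsConfiguration v α) {i : Fin k} {z : ℂ} (hz : z ∈ wedge (v i) (α i)) :
    h.gradient z = v i * pieceGrad (Real.cot (α i)) (z * (starRingEnd ℂ) (v i)) := by
  by_cases hi : h.index z = i
  · rw [gradient, hi]
  · rw [gradient, h.mul_pieceGrad_eq _ (h.re_eq_of_mem_wedge hi (h.mem_wedge_index z) hz),
      h.mul_pieceGrad_eq _ (h.re_eq_of_mem_wedge (Ne.symm hi) hz (h.mem_wedge_index z))]

/-- Near `z`, only the wedges that contain `z` matter. -/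
theorem eventually_of_wedge (h : IsConfiguration v α) {z : ℂ} {P : ℂ → Prop}
    (hP : ∀ i, z ∈ wedge (v i) (α i) → ∀ᶠ y in 𝓝 z, y ∈ wedge (v i) (α i) → P y) :
    ∀ᶠ y in 𝓝 z, P y := by
  have : ∀ᶠ y in 𝓝 z, ∀ i, y ∈ wedge (v i) (α i) → P y := by
    refine eventually_all.2 fun i => ?_
    by_cases hz : z ∈ wedge (v i) (α i)
    · exact hP i hz
    · filter_upwards [(isClosed_wedge (h.unit i) (h.pos i) (h.lt_pi i)).isOpen_compl.mem_nhds hz]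
        with y hy hy'
      exact absurd hy' hy
  filter_upwards [this] with y hy
  exact hy _ (h.mem_wedge_index y)

theorem hasFDerivAt_height (h : IsConfiguration v α) (z : ℂ) :
    HasFDerivAt h.height (innerSL ℝ (h.gradient z)) z := by
  rw [hasFDerivAt_iff_isLittleO, Asymptotics.isLittleO_iff]
  intro c hc
  refine h.eventually_of_wedge fun i hz => ?_
  have h1 := hasFDerivAt_piece_rotated (v i) (Real.cot (α i)) z
  rw [hasFDerivAt_iff_isLittleO, Asymptotics.isLittleO_iff] at h1
  filter_upwards [h1 hc] with y hy hyi
  rw [h.height_eq hz, h.height_eq hyi, h.gradient_eq hz]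
  exact hy

/-- Every point near `z` shares a wedge with `z`, so the Lipschitz bound of that piece applies.
Summing the constants of all pieces gives one valid for every wedge. -/
theorem lipschitzWith_gradient (h : IsConfiguration v α) :
    LipschitzWith (∑ i, (2 + 2 * ‖Real.cot (α i)‖₊)) h.gradient := by
  refine lipschitzWith_of_eventually fun z => h.eventually_of_wedge fun i hz =>
    .of_forall fun y hy => ?_
  rw [h.gradient_eq hz, h.gradient_eq hy, ← dist_eq_norm, ← dist_eq_norm]
  refine ((lipschitzWith_pieceGrad_rotated (h.unit i) (Real.cot (α i))).dist_le_mul y z).trans ?_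
  refine mul_le_mul_of_nonneg_right ?_ dist_nonneg
  exact_mod_cast Finset.single_le_sum (f := fun i => 2 + 2 * ‖Real.cot (α i)‖₊)
    (fun _ _ => zero_le) (Finset.mem_univ i)

theorem tGraph_height (h : IsConfiguration v α) :
    tGraph h.height = wedgeSurface v (fun i _ => α i) := by
  ext p
  simp only [wedgeSurface, Set.mem_iUnion, exists_prop,
    mem_horizontalHalfline_union_iff (h.unit _) (h.pos _) (h.lt_pi _)]
  constructor
  · intro hp
    exact ⟨h.index p.1, _, (mem_wedge_iff (h.unit _) (h.pos _) (h.lt_pi _) _).1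
      (h.mem_wedge_index p.1), rfl, hp⟩
  · rintro ⟨i, s, hs, rfl, hp⟩
    exact hp.trans (h.height_eq ((mem_wedge_iff (h.unit _) (h.pos _) (h.lt_pi _) _).2 hs)).symm

theorem isAreaMinimizing_height (h : IsConfiguration v α) :
    IsAreaMinimizing (subgraph h.height) := by
  refine isAreaMinimizing_subgraph (ρ := fun i => rot (α i) * v i)
    (fun i => by rw [norm_mul, norm_rot, h.unit, one_mul]) h.hasFDerivAt_height
    h.lipschitzWith_gradient.continuous ?_
  -- The axes, on which two border directions tie as maximizers, form a null set.
  filter_upwards [ae_all_iff.2 fun i => ae_im_mul_conj_ne_zero (h.unit i)] with z hz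
  obtain ⟨i, hi⟩ := h.exists_mem_wedge z
  have hcal := fun θ => pieceGrad_calibrated (h.unit i) (h.pos i) (h.lt_pi i) (z := z) (θ := θ)
  rw [← h.gradient_eq hi] at hcal
  have hzi := hz i
  obtain ⟨r, θ, hr, h1, h2, hzr⟩ := hi
  have him : (z * (starRingEnd ℂ) (v i)).im = r * Real.sin θ := by
    rw [hzr, mul_conj_of_eq_smul_rot (h.unit i), smul_rot_im]
  have hr0 : 0 < r := by
    refine lt_of_le_of_ne hr fun h0 => hzi ?_
    rw [him, ← h0, zero_mul]
  have hαπ := h.lt_pi i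
  have hinner := fun τ => rot_mul_inner (h.unit i) τ r θ
  rw [← hzr] at hinner
  rcases lt_trichotomy θ 0 with hθ | hθ | hθ
  · have hsin := Real.sin_neg_of_neg_of_neg_pi_lt hθ (by linarith)
    refine ⟨i - 1, fun j => ?_, ?_⟩
    · obtain ⟨τ, hτ1, hτ2, hτ⟩ := h.exists_angle_border i j
      rw [hτ, ← h.rot_neg_mul, hinner, hinner]
      -- Reflection in the axis, `θ ↦ -θ` and `τ ↦ 2π - τ`, reduces the lower half of the wedge to
      -- the upper one. Its border is `R (i - 1)`, whence the index `i - 1`.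
      rcases eq_or_cos_sub_lt (a := α i) (θ := -θ) (τ := 2 * Real.pi - τ) (by linarith)
        (by linarith) (by linarith) (by linarith) with h3 | h3
      · left
        rw [show τ = -α i + 2 * Real.pi by linarith, rot_add, rot_two_pi, mul_one]
      · right
        rw [show 2 * Real.pi - τ - -θ = 2 * Real.pi - (τ - θ) by ring, Real.cos_two_pi_sub,
          ← Real.cos_neg (α i - -θ), show -(α i - -θ) = -α i - θ by ring] at h3
        exact mul_lt_mul_of_pos_left h3 hr0
    · rw [← h.rot_neg_mul]
      exact hcal _ (Or.inr ⟨by rw [him]; nlinarith, rfl⟩)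
  · exact absurd him (by rw [hθ, Real.sin_zero, mul_zero]; exact hzi)
  · have hsin := Real.sin_pos_of_pos_of_lt_pi hθ (by linarith)
    refine ⟨i, fun j => ?_, hcal _ (Or.inl ⟨by rw [him]; positivity, rfl⟩)⟩
    obtain ⟨τ, hτ1, hτ2, hτ⟩ := h.exists_angle_border i j
    rw [hτ, hinner, hinner]
    rcases eq_or_cos_sub_lt hθ h2 hτ1 hτ2 with h3 | h3
    · left; rw [h3]
    · right; exact mul_lt_mul_of_pos_left h3 hr0

theorem isCone_height (h : IsConfiguration v α) : IsCone (subgraph h.height) 0 := by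
  have := isCone_subgraph (u := h.height) 0 (fun r hr z => ?_) (by simp)
  · rwa [Complex.ofReal_zero] at this
  · have hz := h.mem_wedge_index z
    rw [h.height_eq hz, h.height_eq (smul_mem_wedge hr.le hz), smul_mul_assoc, piece_smul _ hr]

theorem exists_unitNormalField_height (h : IsConfiguration v α) :
    ∃ N : Heis → Heis, IsUnitNormalField h.height N ∧ ContinuousOn N (tGraph h.height) ∧
      LocallyLipschitzOn (tGraph h.height) N ∧
      ∀ i, ∀ z ∈ planarHalfline (rot (α i) * v i),
        N (z, h.height z) = rotationNormal (z, h.height z) := by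
  obtain ⟨N, h1, h2, h3, h4⟩ := exists_unitNormalField h.hasFDerivAt_height
    h.lipschitzWith_gradient (R := {z | h.gradient z = Complex.I * z}) fun z hz => hz
  refine ⟨N, h1, h2, h3, fun i z hz => h4 z ?_⟩
  obtain ⟨s, hs, rfl⟩ := hz
  have hp := h.pos i
  have hmem : s • (rot (α i) * v i) ∈ wedge (v i) (α i) :=
    ⟨s, α i, hs, by linarith, le_rfl, rfl⟩
  refine (h.gradient_eq hmem).trans (h.mul_pieceGrad_eq i ?_)
  have habs := abs_of_pos hp
  rw [mul_conj_of_eq_smul_rot (h.unit i), ← sub_eq_zero,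
    sub_cot_mul_eq hp (h.lt_pi i) hs (by rw [habs]; exact (h.lt_pi i).le), habs]
  simp

theorem singularSet_height (h : IsConfiguration v α) :
    singularSet h.height = ⋃ i, horizontalHalfline 0 (v i) := by
  have hline : ∀ i (p : Heis), p ∈ horizontalHalfline 0 (v i) ↔
      ∃ w : ℝ, 0 ≤ w ∧ p.1 * (starRingEnd ℂ) (v i) = w ∧ p.2 = 0 := by
    intro i p
    refine exists_congr fun w => and_congr_right fun _ => ?_
    have : (0 : Heis) + w • ((v i).re • X 0 + (v i).im • Y 0) = (w * v i, 0) := by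
      refine Prod.ext (Complex.ext ?_ ?_) ?_ <;> simp [X, Y]
    rw [this, Prod.ext_iff]
    refine and_congr_left fun _ => ⟨fun hp => ?_, fun hp => ?_⟩
    · rw [hp, mul_assoc, mul_conj_self (h.unit i), mul_one]
    · rw [← hp, mul_comm]
      exact eq_mul_conj_mul (h.unit i) _
  -- In axis coordinates the real part of the equation reads `-η = η`, so only the axis is singular.
  have hgrad : ∀ i (z : ℂ), z ∈ wedge (v i) (α i) →
      (h.gradient z = -(Complex.I * z) ↔ (z * (starRingEnd ℂ) (v i)).im = 0) := by
    intro i z hz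
    set w := z * (starRingEnd ℂ) (v i) with hw
    have hzw : z = v i * w := eq_mul_conj_mul (h.unit i) z
    have hv : v i ≠ 0 := norm_ne_zero_iff.1 (by rw [h.unit]; norm_num)
    have h1 : h.gradient z = -(Complex.I * z) ↔
        pieceGrad (Real.cot (α i)) w = -(Complex.I * w) := by
      rw [h.gradient_eq hz, show -(Complex.I * z) = v i * -(Complex.I * w) by
        linear_combination (-Complex.I) * hzw, ← hw]
      exact mul_right_inj' hv
    rw [h1]
    constructor
    · intro h2
      have := congrArg Complex.re h2
      simp [pieceGrad] at this
      linarith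
    · intro h2
      apply Complex.ext <;> simp [pieceGrad, h2]
  rw [singularSet_eq h.hasFDerivAt_height]
  ext p
  simp only [Set.mem_iUnion, hline]
  constructor
  · rintro ⟨hp, hg⟩
    have hz := h.mem_wedge_index p.1
    have him := (hgrad _ _ hz).1 hg
    have hre := (mem_wedge_iff (h.unit _) (h.pos _) (h.lt_pi _) _).1 hz
    rw [him, abs_zero, mul_zero, sub_zero] at hre
    refine ⟨h.index p.1, _, hre, Complex.ext (by simp) (by simpa using him), ?_⟩
    rw [show p.2 = h.height p.1 from hp, h.height_eq hz, piece, him]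
    simp
  · rintro ⟨i, w, hw, h1, h2⟩
    have hz : p.1 ∈ wedge (v i) (α i) := by
      rw [mem_wedge_iff (h.unit _) (h.pos _) (h.lt_pi _), h1]
      simpa using hw
    refine ⟨?_, (hgrad i _ hz).2 (by rw [h1]; simp)⟩
    change p.2 = h.height p.1
    rw [h2, h.height_eq hz, h1]
    simp [piece]

end IsConfiguration

end Heis

theorem mainTheorem4 :
    (∀ (k : ℕ) [NeZero k] (v : Fin k → ℂ) (α : Fin k → ℝ), Heis.IsConfiguration v α →
      ∃ u : ℂ → ℝ,
        Heis.tGraph u = Heis.wedgeSurface v (fun i _ => α i) ∧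
        Heis.IsAreaMinimizing (Heis.subgraph u) ∧
        Heis.IsCone (Heis.subgraph u) 0 ∧
        (∀ i, Heis.IsC11On u (interior (Heis.wedge (v i) (α i)))) ∧
        ContDiff ℝ 1 u ∧
        (∃ N : Heis → Heis, Heis.IsUnitNormalField u N ∧
          ContinuousOn N (Heis.tGraph u) ∧
          LocallyLipschitzOn (Heis.tGraph u) N ∧
          ∀ i, ∀ z ∈ Heis.planarHalfline (Heis.rot (α i) * v i),
            N (z, u z) = Heis.rotationNormal (z, u z)) ∧
        Heis.singularSet u = ⋃ i, Heis.horizontalHalfline 0 (v i)) ∧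
    (∀ α₀ : ℝ, 0 < α₀ → α₀ < Real.pi →
      ∃ u : ℂ → ℝ,
        Heis.tGraph u = Heis.lineSurface (fun _ => α₀) ∧
        (∀ z : ℂ, u z = -(z.re * z.im) + Real.cot α₀ * (z.im * |z.im|)) ∧
        Heis.IsAreaMinimizing (Heis.subgraph u) ∧
        (∀ x : ℝ, Heis.IsCone (Heis.subgraph u) ((x : ℂ), 0)) ∧
        Heis.IsC11On u Set.univ ∧
        (∃ N : Heis → Heis, Heis.IsUnitNormalField u N ∧
          ContinuousOn N (Heis.tGraph u) ∧
          LocallyLipschitzOn (Heis.tGraph u) N ∧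
          ∀ z : ℂ, z.re = Real.cot α₀ * |z.im| →
            N (z, u z) = Heis.rotationNormal (z, u z)) ∧
        Heis.singularSet u = {p | ∃ x : ℝ, p = ((x : ℂ), 0)}) := by
  refine ⟨fun k _ v α h => ?_, Heis.exists_graph_lineSurface⟩
  exact ⟨h.height, h.tGraph_height, h.isAreaMinimizing_height, h.isCone_height,
    fun i => Heis.isC11On h.hasFDerivAt_height h.lipschitzWith_gradient _,
    Heis.contDiff_of_gradient h.hasFDerivAt_height h.lipschitzWith_gradient.continuous,
    h.exists_unitNormalField_height, h.singularSet_height⟩
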